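/- **Setting.** A housing market $(A,H,P,\mu_0)$ has $n$ agents and $n$ houses ($n\ge 0$). Each agent $a$ has a strict total order $\prec_a$ on a subset of the houses, its acceptable houses ($h\prec_a h'$ means that $a$ prefers $h$ to $h'$). A matching $\mu$ assigns to each agent $a$ at most one house $\mu(a)$, acceptable to $a$, and no house to two agents. Every acceptable house is preferred to being unmatched. The initial endowment $\mu_0$ is a matching in which every agent has a house. Write $x\preceq_a y$ if $x=y$ or $x\prec_a y$. A matching $\mu$ is *individually rational* if $\mu(a)\preceq_a\mu_0(a)$ for all $a$. It is *Pareto optimal* if there is no matching $\nu$ with $\nu(a)\preceq_a\mu(a)$ for all $a$ and $\nu(a)\prec_a\mu(a)$ for some $a$. A set $A'\subseteq A$ is a *coalition* with respect to $\mu$ if there is a matching $\nu$ with $\nu(a)\in\{\mu_0(b): b\in A'\}$ and $\nu(a)\preceq_a\mu(a)$ for all $a\in A'$, and $\nu(a)\prec_a\mu(a)$ for some $a\in A'$. The *core* is the set of all matchings with respect to which there is no coalition. A problem is in **NC** if a single CREW PRAM program decides it with a number of processors polynomial in the length $N$ of the input, with words of $O(\log N)$ bits, and in time polylogarithmic in $N$.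 **Theorem.** Given a housing market $(A,H,P,\mu_0)$ (with its preference lists) and a matching $\mu$ in it, the following two tasks can be performed in **NC**: 1. verifying whether $\mu$ is individually rational and Pareto optimal; 2. verifying whether $\mu$ is the unique core, i.e. whether the core equals $\{\mu\}$. Moreover: * If $\mu$ is individually rational, then $\mu$ is Pareto optimal if and only if the digraph on $A$ with an arc from $u$ to $v$ whenever $\mu(v)\prec_u\mu(u)$ has no directed cycle. * The core equals $\{\mu\}$ if and only if the digraph on $A$ with a solid arc from $u$ to $v$ whenever $\mu(u)=\mu_0(v)$ and a dashed arc from $u$ to $v$ whenever $\mu_0(v)\prec_u\mu(u)$ has no directed cycle (loops included) that contains a dashed arc. -/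

import Mathlib

/-! ## Housing allocation and housing markets -/

/-- A housing allocation instance with `n` agents and `m` houses. The strict preference of an agent
is a strict total order on the subset of its acceptable houses, given by its preference list: the
acceptable houses, best house first, without repetition. -/
structure HousingAllocation (n m : ℕ) where
  pref : Fin n → List (Fin m)
  pref_nodup : ∀ a, (pref a).Nodup

namespace HousingAllocation

variable {n m : ℕ}

/-- A matching of agents to acceptable houses; `house a = none` says that `a` is unmatched. -/
@[ext]
structure Matching (I : HousingAllocation n m) where
  house : Fin n → Option (Fin m)
  acceptable : ∀ a h, house a = some h → h ∈ I.pref a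
  injective : ∀ a b h, house a = some h → house b = some h → a = b

/-- `I.Prefers a x y`: agent `a` strictly prefers `x` to `y`, written `x ≺_a y`. Houses are compared
by their position in the preference list of `a`, and every acceptable house is strictly better than
being unmatched (`none`). -/
def Prefers (I : HousingAllocation n m) (a : Fin n) : Option (Fin m) → Option (Fin m) → Prop
  | some h, some h' => ∃ i j : ℕ, i < j ∧ (I.pref a)[i]? = some h ∧ (I.pref a)[j]? = some h'
  | some h, none => h ∈ I.pref a
  | none, _ => False

/-- `x ⪯_a y`: agent `a` finds `x` at least as good as `y`. -/
def WeaklyPrefers (I : HousingAllocation n m) (a : Fin n) (x y : Option (Fin m)) : Prop :=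
  x = y ∨ I.Prefers a x y

variable {I : HousingAllocation n m}

/-- `μ` Pareto dominates `ν`. -/
def Matching.ParetoDominates (μ ν : I.Matching) : Prop :=
  (∀ a, I.WeaklyPrefers a (μ.house a) (ν.house a)) ∧
    ∃ a, I.Prefers a (μ.house a) (ν.house a)

/-- `μ` is Pareto optimal: no matching Pareto dominates it. -/
def Matching.ParetoOptimal (μ : I.Matching) : Prop :=
  ¬ ∃ ν : I.Matching, ν.ParetoDominates μ

end HousingAllocation

/-- A housing market `(A, H, P, μ₀)` with `n` agents and `n` houses: a housing allocation instance
with an initial endowment `μ₀`, a matching in which every agent owns a house. -/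
structure HousingMarket (n : ℕ) extends HousingAllocation n n where
  endowment : toHousingAllocation.Matching
  endowment_perfect : ∀ a, (endowment.house a).isSome

namespace HousingMarket

variable {n : ℕ}

/-- Matchings of agents to houses in the market `M`. -/
abbrev Matching (M : HousingMarket n) : Type := M.toHousingAllocation.Matching

def IndividuallyRational (M : HousingMarket n) (μ : M.Matching) : Prop :=
  ∀ a, M.WeaklyPrefers a (μ.house a) (M.endowment.house a)

/-- The set of agents `S` forms a coalition with respect to `μ`. -/
def IsCoalition (M : HousingMarket n) (μ : M.Matching) (S : Set (Fin n)) : Prop :=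
  ∃ ν : M.Matching,
    (∀ a ∈ S, ∃ b ∈ S, ν.house a = M.endowment.house b) ∧
    (∀ a ∈ S, M.WeaklyPrefers a (ν.house a) (μ.house a)) ∧
    ∃ a ∈ S, M.Prefers a (ν.house a) (μ.house a)

/-- The core: the set of all matchings with respect to which there is no coalition. -/
def core (M : HousingMarket n) : Set M.Matching :=
  {μ | ¬ ∃ S, M.IsCoalition μ S}

/-- Envy digraph of `μ`: an arc from `u` to `v` if `u` prefers the house of `v` to its own. -/
def EnvyArc (M : HousingMarket n) (μ : M.Matching) (u v : Fin n) : Prop :=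
  M.Prefers u (μ.house v) (μ.house u)

/-- Solid arc from `u` to `v`: in `μ`, agent `u` gets the house initially owned by `v`. -/
def SolidArc (M : HousingMarket n) (μ : M.Matching) (u v : Fin n) : Prop :=
  μ.house u = M.endowment.house v

/-- Dashed arc from `u` to `v`: agent `u` prefers the house initially owned by `v` to the house
that it gets in `μ`. -/
def DashedArc (M : HousingMarket n) (μ : M.Matching) (u v : Fin n) : Prop :=
  M.Prefers u (M.endowment.house v) (μ.house u)

end HousingMarket

/-- `c 0 → c 1 → ⋯ → c k → c 0` is a directed cycle (on distinct vertices) of the digraph with arc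
relation `r`. Addition in `Fin (k + 1)` wraps around; `k = 0` is a loop. -/
def IsDirectedCycle {V : Type} (r : V → V → Prop) {k : ℕ} (c : Fin (k + 1) → V) : Prop :=
  Function.Injective c ∧ ∀ i, r (c i) (c (i + 1))

/-! ## The CREW PRAM and the class NC -/

namespace PRAM

/-- Arithmetic operations on words: truncated subtraction, integer division (`0` for the divisor
`0`), remainder, and the comparisons `<` and `=` with value `0` or `1`. -/
inductive Op where
  | add | sub | mul | div | mod | lt | eq

def Op.eval : Op → ℕ → ℕ → ℕ
  | add, x, y => x + y
  | sub, x, y => x - y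
  | mul, x, y => x * y
  | div, x, y => x / y
  | mod, x, y => x % y
  | lt, x, y => if x < y then 1 else 0
  | eq, x, y => if x = y then 1 else 0

/-- Instructions. Registers are local to a processor and are named by constants of the program;
the memory is shared by all processors and is addressed through registers.
* `const r v`: put the constant `v` into register `r`;
* `arith o r a b`: put the result of `o`, applied to registers `a` and `b`, into register `r`;
* `load r a`: read the memory cell whose address is in register `a` into register `r`;
* `store a r`: write register `r` to the memory cell whose address is in register `a`;
* `jumpIfZero r l`: go on at instruction `l` if register `r` holds `0`. -/
inductive Instr where
  | const (r v : ℕ)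
  | arith (o : Op) (r a b : ℕ)
  | load (r a : ℕ)
  | store (a r : ℕ)
  | jumpIfZero (r l : ℕ)

/-- A program: a finite list of instructions, executed by every processor. -/
abbrev Program : Type := List Instr

/-- Local state of a processor: program counter and registers. -/
structure LocalState where
  pc : ℕ
  reg : ℕ → ℕ

/-- Configuration of a machine with `p` processors. -/
structure Config (p : ℕ) where
  proc : Fin p → LocalState
  mem : ℕ → ℕ

/-- The processor has halted: its program counter is past the end of the program. -/
def LocalState.Halted (P : Program) (s : LocalState) : Prop :=
  P.length ≤ s.pc

/-- The local effect of one step, with the given contents of the shared memory. -/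
def LocalState.next (P : Program) (mem : ℕ → ℕ) (s : LocalState) : LocalState :=
  match P[s.pc]? with
  | none => s
  | some (.const r v) => ⟨s.pc + 1, Function.update s.reg r v⟩
  | some (.arith o r a b) => ⟨s.pc + 1, Function.update s.reg r (o.eval (s.reg a) (s.reg b))⟩
  | some (.load r a) => ⟨s.pc + 1, Function.update s.reg r (mem (s.reg a))⟩
  | some (.store _ _) => ⟨s.pc + 1, s.reg⟩
  | some (.jumpIfZero r l) => ⟨if s.reg r = 0 then l else s.pc + 1, s.reg⟩

/-- The pair (address, value) that the processor writes in this step, if it writes. -/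
def LocalState.request (P : Program) (s : LocalState) : Option (ℕ × ℕ) :=
  match P[s.pc]? with
  | some (.store a r) => some (s.reg a, s.reg r)
  | _ => none

variable {p : ℕ}

/-- Exclusive write: no two processors write to the same memory cell in this step. -/
def Config.ExclusiveWrite (P : Program) (c : Config p) : Prop :=
  ∀ (i j : Fin p) (a v w : ℕ), (c.proc i).request P = some (a, v) →
    (c.proc j).request P = some (a, w) → i = j

/-- One synchronous step of all processors: all of them read the old memory, and then the writes
take effect. (If several processors wrote to one cell, the first one would win; such steps are
excluded by `ExclusiveWrite`.) -/
def Config.step (P : Program) (c : Config p) : Config p where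
  proc i := (c.proc i).next P c.mem
  mem a := ((List.finRange p).findSome? fun i =>
    ((c.proc i).request P).bind fun q => if q.1 = a then some q.2 else none).getD (c.mem a)

/-- Initial configuration on the bit string `x`: memory cell `i` holds bit `i` of `x`, all further
cells hold `0`; register `0` holds the number of the processor, register `1` the length of `x`,
all further registers hold `0`. -/
def init (p : ℕ) (x : List Bool) : Config p where
  proc i := ⟨0, fun r => if r = 0 then (i : ℕ) else if r = 1 then x.length else 0⟩
  mem a := if x[a]? = some true then 1 else 0

/-- The configuration after `t` steps of program `P` on input `x` with `p` processors. -/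
def run (P : Program) (p : ℕ) (x : List Bool) (t : ℕ) : Config p :=
  (Config.step P)^[t] (init p x)

/-- On input `x`, the machine with program `P` and `p` processors halts within `T` steps, obeys the
exclusive-write rule, and all its words (numbers in registers and in memory, hence also all
addresses used) stay below `W`. -/
structure RunsWithin (P : Program) (p T W : ℕ) (x : List Bool) : Prop where
  halts : ∀ i, ((run P p x T).proc i).Halted P
  exclusive : ∀ t, (run P p x t).ExclusiveWrite P
  reg_lt : ∀ t i r, ((run P p x t).proc i).reg r < W
  mem_lt : ∀ t a, (run P p x t).mem a < W

/-- `InNC enc Q`: the problem to decide, given (the encoding `enc z` of) an instance `z : ι`,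
whether `Q z` holds, is in NC. That is, a single CREW PRAM program decides it with a number of
processors polynomial in the length `N` of the input, words of `O(log N)` bits, and time
polylogarithmic in `N`; the machine accepts if memory cell `0` holds `1` in the end.
(`N + 2` is written for `N` to make the bounds meaningful for `N = 0` and `N = 1`.) -/
def InNC {ι : Type} (enc : ι → List Bool) (Q : ι → Prop) : Prop :=
  ∃ (P : Program) (procExp wordExp timeFactor timeExp : ℕ), ∀ z : ι,
    let N := (enc z).length
    let p := (N + 2) ^ procExp
    let T := timeFactor * Nat.log 2 (N + 2) ^ timeExp
    RunsWithin P p T ((N + 2) ^ wordExp) (enc z) ∧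
      ((run P p (enc z) T).mem 0 = 1 ↔ Q z)

end PRAM

/-! ## The input of the verification problems -/

/-- A housing market together with a matching in it. -/
structure MarketWithMatching where
  n : ℕ
  market : HousingMarket n
  matching : market.Matching

/-- The `0`-`1` matrix of a matching, row by row: entry `(a, h)` is `1` iff `a` is matched to `h`. -/
def HousingAllocation.Matching.bits {n m : ℕ} {I : HousingAllocation n m} (μ : I.Matching) :
    List Bool :=
  List.ofFn fun i : Fin (n * m) => decide (μ.house i.divNat = some i.modNat)

/-- The preference lists as a bit string: bit `(a, k, h)`, in lexicographic order, is `1` iff `h` is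
the house at position `k` of the preference list of `a`. -/
def HousingAllocation.bits {n m : ℕ} (I : HousingAllocation n m) : List Bool :=
  List.ofFn fun i : Fin (n * m * m) =>
    decide ((I.pref i.divNat.divNat)[(i.divNat.modNat : ℕ)]? = some i.modNat)

/-- Encoding of a market and a matching, of length `n ^ 3 + 2 * n ^ 2`: preference lists,
initial endowment, matching. -/
def MarketWithMatching.encode (z : MarketWithMatching) : List Bool :=
  z.market.toHousingAllocation.bits ++ z.market.endowment.bits ++ z.matching.bits

/-!
Both criteria rest on one observation: going from agent to agent along a permutation of a finite set
one returns to the start, so that an improvement of a matching splits into cycles of a digraph on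
the agents, and conversely a cycle prescribes a trade.

If `μ` is individually rational, every agent has a house in `μ`, and a matching that Pareto
dominates `μ` is `μ` composed with a permutation; every agent that this permutation moves envies the
next one on its cycle (`IndividuallyRational.paretoOptimal_iff`). Likewise a coalition permutes the
initial houses of its members along solid and dashed arcs, so that `μ` is in the core if and only if
no cycle contains a dashed arc (`mem_core_iff`). The core has at most one element
(`eq_of_mem_core`): induction along the dashed arcs shows that any other matching in the core agrees
with `μ` on one trading cycle after the other.

For the parallel complexity, the reasons to reject (an unmatched agent, an agent that prefers its
initial house, a closed walk through a strict arc) are found by a nondeterministic search that keeps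
eight numbers less than `N + 2`, where `N` is the length of the input (`ConfigArc`,
`reflTransGen_arc_iff`). Hence each problem is the complement of reachability of the vertex `1`
from the vertex `0` in a graph whose vertices are given by eight digits to the base `N + 2` and
whose arcs are described by an arithmetic expression in the digits and in single bits of the
input.

Such a reachability problem is decided by one program (`inNC_of_reach`). With `Y` vertices there is
a processor for each triple `(a, b, m)`, where `m` is a gate of a binary tree with a leaf for each
vertex `k`; the leaf is the conjunction of "`k` is reachable from `a`" and "`b` is reachable from
`k`", the other gates are disjunctions, and the root is "`b` is reachable from `a`". All gates are
updated synchronously. Climbing the tree, which takes `O(log Y)` steps, doubles the length of the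
walks that have been found, so `O(log ^ 2 Y)` steps suffice (`gate_iff_reach`). All processors
are at the same instruction at any time, and each of them writes only to the memory cell with its
own number, which makes the writes exclusive. Word sizes are bounded by assigning to each register
an exponent that all instructions respect (`Instr.Fits`).
-/

namespace PRAM

/-! ### Size of words -/

/-- If `x < X ^ e` and `y < X ^ f` with `2 ≤ X`, then the result of the operation on `x` and `y` is
less than `X ^ o.exp e f`. -/
def Op.exp : Op → ℕ → ℕ → ℕ
  | add, e, f => max e f + 1
  | sub, e, _ => e
  | mul, e, f => e + f
  | div, e, _ => e
  | mod, e, _ => e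
  | lt, _, _ => 1
  | eq, _, _ => 1

theorem Op.eval_lt (o : Op) {X x y e f : ℕ} (hX : 2 ≤ X) (hx : x < X ^ e) (hy : y < X ^ f) :
    o.eval x y < X ^ o.exp e f := by
  cases o with
  | add =>
    have h1 : X ^ e ≤ X ^ max e f := Nat.pow_le_pow_right (by omega) (le_max_left _ _)
    have h2 : X ^ f ≤ X ^ max e f := Nat.pow_le_pow_right (by omega) (le_max_right _ _)
    have h3 : X ^ max e f * 2 ≤ X ^ max e f * X := Nat.mul_le_mul_left _ hX
    simp only [Op.eval, Op.exp, pow_succ]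
    omega
  | sub => exact lt_of_le_of_lt (Nat.sub_le _ _) hx
  | mul =>
    simp only [Op.eval, Op.exp, pow_add]
    exact Nat.mul_lt_mul'' hx hy
  | div => exact lt_of_le_of_lt (Nat.div_le_self _ _) hx
  | mod => exact lt_of_le_of_lt (Nat.mod_le _ _) hx
  | lt => simp only [Op.eval, Op.exp, pow_one]; split_ifs <;> omega
  | eq => simp only [Op.eval, Op.exp, pow_one]; split_ifs <;> omega

/-- The instruction respects the word sizes `reg r < X ^ Γ r` and `mem a < X`, leaves register `0`
(the number of the processor) alone, and writes only to the memory cell whose address is the number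
of the processor. -/
def Instr.Fits (Γ : ℕ → ℕ) : Instr → Prop
  | const r v => r ≠ 0 ∧ v ≤ Γ r
  | arith o r a b => r ≠ 0 ∧ o.exp (Γ a) (Γ b) ≤ Γ r
  | load r _ => r ≠ 0 ∧ 1 ≤ Γ r
  | store a r => a = 0 ∧ Γ r ≤ 1
  | jumpIfZero _ _ => True

instance (Γ : ℕ → ℕ) : DecidablePred (Instr.Fits Γ) := fun I => by
  cases I <;> simp only [Instr.Fits] <;> infer_instance

variable {p : ℕ}

/-- All words of the configuration obey the bounds given by `Γ`, and register `0` of each processor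
holds its number. -/
structure Config.Fits (Γ : ℕ → ℕ) (X : ℕ) (c : Config p) : Prop where
  reg_zero : ∀ i, (c.proc i).reg 0 = i
  reg_lt : ∀ i r, (c.proc i).reg r < X ^ Γ r
  mem_lt : ∀ a, c.mem a < X

theorem Config.Fits.next_reg {Γ : ℕ → ℕ} {X : ℕ} {P : Program} {c : Config p} (hX : 2 ≤ X)
    (hP : ∀ I ∈ P, Instr.Fits Γ I) (hc : c.Fits Γ X) (i : Fin p) :
    ((c.proc i).next P c.mem).reg 0 = i ∧ ∀ r, ((c.proc i).next P c.mem).reg r < X ^ Γ r := by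
  have key : ∀ r v : ℕ, r ≠ 0 → v < X ^ Γ r →
      Function.update (c.proc i).reg r v 0 = i ∧
        ∀ q, Function.update (c.proc i).reg r v q < X ^ Γ q := by
    intro r v hr hv
    refine ⟨by rw [Function.update_of_ne hr.symm]; exact hc.reg_zero i, fun q => ?_⟩
    rcases eq_or_ne q r with rfl | hq
    · simpa using hv
    · rw [Function.update_of_ne hq]; exact hc.reg_lt i q
  have hmono : ∀ {x e f : ℕ}, x < X ^ e → e ≤ f → x < X ^ f := fun hx h =>
    lt_of_lt_of_le hx (Nat.pow_le_pow_right (by omega) h)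
  unfold LocalState.next
  rcases hI : P[(c.proc i).pc]? with _ | I
  · exact ⟨hc.reg_zero i, hc.reg_lt i⟩
  · have hF := hP I (List.mem_of_getElem? hI)
    cases I with
    | const r v =>
      refine key r v hF.1 (hmono (e := v) ?_ hF.2)
      exact lt_of_lt_of_le Nat.lt_two_pow_self (Nat.pow_le_pow_left hX v)
    | arith o r a b =>
      exact key r _ hF.1 (hmono (o.eval_lt hX (hc.reg_lt i a) (hc.reg_lt i b)) hF.2)
    | load r a => exact key r _ hF.1 (hmono (e := 1) (by simpa using hc.mem_lt _) hF.2)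
    | store a r => exact ⟨hc.reg_zero i, hc.reg_lt i⟩
    | jumpIfZero r l => exact ⟨hc.reg_zero i, hc.reg_lt i⟩

theorem LocalState.request_eq_some {P : Program} {s : LocalState} {q : ℕ × ℕ}
    (h : s.request P = some q) : ∃ a r, Instr.store a r ∈ P ∧ q = (s.reg a, s.reg r) := by
  unfold LocalState.request at h
  split at h
  · rename_i a r hI
    exact ⟨a, r, List.mem_of_getElem? hI, by simpa using h.symm⟩
  · simp at h

theorem Config.Fits.step {Γ : ℕ → ℕ} {X : ℕ} {P : Program} {c : Config p} (hX : 2 ≤ X)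
    (hP : ∀ I ∈ P, Instr.Fits Γ I) (hc : c.Fits Γ X) : (c.step P).Fits Γ X where
  reg_zero i := (hc.next_reg hX hP i).1
  reg_lt i := (hc.next_reg hX hP i).2
  mem_lt a := by
    simp only [Config.step]
    rcases h : (List.finRange p).findSome? fun i =>
      ((c.proc i).request P).bind fun q => if q.1 = a then some q.2 else none with _ | v
    · simpa using hc.mem_lt a
    · obtain ⟨i, -, hi⟩ := List.exists_of_findSome?_eq_some h
      obtain ⟨q, hq, hv⟩ := Option.bind_eq_some_iff.1 hi
      obtain ⟨b, r, hm, rfl⟩ := LocalState.request_eq_some hq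
      have hF := hP _ hm
      split_ifs at hv
      obtain rfl : (c.proc i).reg r = v := by simpa using hv
      exact lt_of_lt_of_le (hc.reg_lt i r)
        (by simpa using Nat.pow_le_pow_right (n := X) (by omega) hF.2)

theorem Config.Fits.exclusiveWrite {Γ : ℕ → ℕ} {X : ℕ} {P : Program} {c : Config p}
    (hP : ∀ I ∈ P, Instr.Fits Γ I) (hc : c.Fits Γ X) : c.ExclusiveWrite P := by
  have key : ∀ (i : Fin p) (a v : ℕ), (c.proc i).request P = some (a, v) → a = i := by
    intro i a v h
    obtain ⟨b, r, hm, hq⟩ := LocalState.request_eq_some h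
    have hF := hP _ hm
    obtain rfl : b = 0 := hF.1
    rw [hc.reg_zero] at hq
    exact (Prod.mk.inj hq).1
  intro i j a v w hi hj
  exact Fin.ext ((key i a v hi).symm.trans (key j a w hj))

/-- The bounds on words hold at all times, whatever the control flow. -/
theorem run_fits {Γ : ℕ → ℕ} {X : ℕ} {P : Program} {x : List Bool} (hX : x.length < X)
    (hX2 : 2 ≤ X) (hP : ∀ I ∈ P, Instr.Fits Γ I) (h0 : p ≤ X ^ Γ 0) (h1 : 1 ≤ Γ 1) (t : ℕ) :
    (run P p x t).Fits Γ X := by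
  induction t with
  | zero =>
    refine ⟨fun i => rfl, fun i r => ?_, fun a => ?_⟩
    · simp only [run, init, Function.iterate_zero, id]
      split_ifs with hr hr'
      · subst hr; exact lt_of_lt_of_le i.2 h0
      · subst hr'
        exact lt_of_lt_of_le hX (by simpa using Nat.pow_le_pow_right (n := X) (by omega) h1)
      · exact Nat.pow_pos (by omega)
    · simp only [run, init, Function.iterate_zero, id]
      split_ifs <;> omega
  | succ t ih =>
    rw [run, Function.iterate_succ_apply']
    exact ih.step hX2 hP

theorem step_eq_self {P : Program} {c : Config p} (h : ∀ i, (c.proc i).Halted P) :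
    c.step P = c := by
  have hn : ∀ i, P[(c.proc i).pc]? = none := fun i => List.getElem?_eq_none (h i)
  have h1 : ∀ i, (c.proc i).next P c.mem = c.proc i := fun i => by
    simp [LocalState.next, hn i]
  have h2 : ∀ i, (c.proc i).request P = none := fun i => by simp [LocalState.request, hn i]
  cases c with
  | mk proc mem =>
    simp only [Config.step, Config.mk.injEq]
    refine ⟨funext h1, funext fun a => ?_⟩
    have : ((List.finRange p).findSome? fun i =>
        ((proc i).request P).bind fun q => if q.1 = a then some q.2 else none) = none := by
      rw [List.findSome?_eq_none_iff]
      intro i _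
      have := h2 i
      simp only at this
      rw [this]; rfl
    rw [this]; rfl

/-! ### Synchronous execution -/

/-- The configuration in which all processors are at instruction `k`. -/
def lock (k : ℕ) (ρ : Fin p → ℕ → ℕ) (mem : ℕ → ℕ) : Config p :=
  ⟨fun i => ⟨k, ρ i⟩, mem⟩

/-- The instruction neither writes to the shared memory nor jumps. -/
def Instr.IsLocal : Instr → Prop
  | const _ _ => True
  | arith _ _ _ _ => True
  | load _ _ => True
  | _ => False

/-- Effect of a local instruction on the registers. -/
def Instr.exec (mem : ℕ → ℕ) : Instr → (ℕ → ℕ) → ℕ → ℕ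
  | const r v, ρ => Function.update ρ r v
  | arith o r a b, ρ => Function.update ρ r (o.eval (ρ a) (ρ b))
  | load r a, ρ => Function.update ρ r (mem (ρ a))
  | _, ρ => ρ

/-- Effect of a block of local instructions on the registers. -/
def execs (mem : ℕ → ℕ) (B : List Instr) (ρ : ℕ → ℕ) : ℕ → ℕ :=
  B.foldl (fun ρ I => I.exec mem ρ) ρ

theorem execs_nil (mem ρ : ℕ → ℕ) : execs mem [] ρ = ρ := rfl

theorem execs_cons (mem : ℕ → ℕ) (I : Instr) (B : List Instr) (ρ : ℕ → ℕ) :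
    execs mem (I :: B) ρ = execs mem B (I.exec mem ρ) := rfl

theorem execs_append (mem : ℕ → ℕ) (B B' : List Instr) (ρ : ℕ → ℕ) :
    execs mem (B ++ B') ρ = execs mem B' (execs mem B ρ) := List.foldl_append

theorem step_lock_local {P : Program} {k : ℕ} {I : Instr} (hk : P[k]? = some I) (hI : I.IsLocal)
    (ρ : Fin p → ℕ → ℕ) (mem : ℕ → ℕ) :
    (lock k ρ mem).step P = lock (k + 1) (fun i => I.exec mem (ρ i)) mem := by
  have hm : ∀ a, ((List.finRange p).findSome? fun i =>
      (LocalState.request P ⟨k, ρ i⟩).bind fun q => if q.1 = a then some q.2 else none) =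
        none := by
    intro a
    rw [List.findSome?_eq_none_iff]
    intro i _
    cases I <;> simp_all [LocalState.request, Instr.IsLocal]
  simp only [Config.step, lock, Config.mk.injEq]
  refine ⟨funext fun i => ?_, funext fun a => ?_⟩
  · cases I <;> simp_all [LocalState.next, Instr.exec, Instr.IsLocal]
  · rw [hm]; rfl

theorem step_lock_store {P : Program} {k r : ℕ} (hk : P[k]? = some (.store 0 r))
    {ρ : Fin p → ℕ → ℕ} (h0 : ∀ i, ρ i 0 = i) (mem : ℕ → ℕ) :
    (lock k ρ mem).step P =
      lock (k + 1) ρ (fun a => if h : a < p then ρ ⟨a, h⟩ r else mem a) := by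
  simp only [Config.step, lock, Config.mk.injEq]
  refine ⟨funext fun i => by simp [LocalState.next, hk], funext fun a => ?_⟩
  have hreq : ∀ i, LocalState.request P ⟨k, ρ i⟩ = some ((i : ℕ), ρ i r) := fun i => by
    simp [LocalState.request, hk, h0]
  simp only [hreq, Option.bind_some]
  rcases h : (List.finRange p).findSome? fun i : Fin p =>
      if (i : ℕ) = a then some (ρ i r) else none with _ | v
  · rw [List.findSome?_eq_none_iff] at h
    split_ifs with ha
    · simpa using h ⟨a, ha⟩ (List.mem_finRange _)
    · rfl
  · obtain ⟨i, -, hi⟩ := List.exists_of_findSome?_eq_some h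
    split_ifs at hi with hia
    subst hia
    have hv : ρ i r = v := by simpa using hi
    simp [hv]

theorem step_lock_jump {P : Program} {k r l : ℕ} (hk : P[k]? = some (.jumpIfZero r l))
    {ρ : Fin p → ℕ → ℕ} {x : ℕ} (hx : ∀ i, ρ i r = x) (mem : ℕ → ℕ) :
    (lock k ρ mem).step P = lock (if x = 0 then l else k + 1) ρ mem := by
  have hm : ∀ a, ((List.finRange p).findSome? fun i =>
      (LocalState.request P ⟨k, ρ i⟩).bind fun q => if q.1 = a then some q.2 else none) =
        none := by
    intro a
    rw [List.findSome?_eq_none_iff]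
    intro i _
    simp [LocalState.request, hk]
  simp only [Config.step, lock, Config.mk.injEq]
  refine ⟨funext fun i => by simp [LocalState.next, hk, hx], funext fun a => ?_⟩
  rw [hm]; rfl

theorem iterate_step_lock_block (P₁ B P₂ : List Instr) (hB : ∀ I ∈ B, I.IsLocal)
    (ρ : Fin p → ℕ → ℕ) (mem : ℕ → ℕ) :
    (Config.step (P₁ ++ B ++ P₂))^[B.length] (lock P₁.length ρ mem) =
      lock (P₁.length + B.length) (fun i => execs mem B (ρ i)) mem := by
  induction B generalizing P₁ ρ with
  | nil => rfl
  | cons I B ih =>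
    have h1 := ih (P₁ ++ [I]) (fun J hJ => hB J (List.mem_cons_of_mem _ hJ))
      (fun i => I.exec mem (ρ i))
    rw [List.length_cons, Function.iterate_succ_apply,
      step_lock_local (I := I) (by simp) (hB I List.mem_cons_self)]
    simp only [List.append_assoc, List.cons_append, List.nil_append, List.length_append,
      List.length_singleton] at h1 ⊢
    rw [h1]
    simp only [execs_cons]
    congr 1
    omega

/-! ### Expressions -/

/-- Arithmetic expressions over the length of the input, eight numbers `src i` and eight numbers
`tgt i` (the digits of the two ends of an arc), and the contents of the memory. -/
inductive Expr where
  | const (v : ℕ)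
  | len
  | src (i : Fin 8)
  | tgt (i : Fin 8)
  | op (o : Op) (e f : Expr)
  | load (e : Expr)

namespace Expr

/-- Value of the expression. -/
def eval (mem : ℕ → ℕ) (N : ℕ) (x y : Fin 8 → ℕ) : Expr → ℕ
  | const v => v
  | len => N
  | src i => x i
  | tgt i => y i
  | op o e f => o.eval (e.eval mem N x y) (f.eval mem N x y)
  | load e => mem (e.eval mem N x y)

/-- Number of registers used to evaluate the expression. -/
def size : Expr → ℕ
  | const _ => 1
  | len | src _ | tgt _ => 0
  | op _ e f => e.size + f.size + 1
  | load e => e.size + 1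

/-- The register that holds the value of the expression after `code e r` has been executed. -/
def out : Expr → ℕ → ℕ
  | const _, r => r
  | len, _ => 1
  | src i, _ => 50 + i
  | tgt i, _ => 60 + i
  | op _ e f, r => r + e.size + f.size
  | load e, r => r + e.size

/-- Code that evaluates the expression, using the registers from `r` on, each of them once. The
length of the input is expected in register `1`, the numbers `src i` and `tgt i` in the registers
`50 + i` and `60 + i`. -/
def code : Expr → ℕ → List Instr
  | const v, r => [.const r v]
  | len, _ | src _, _ | tgt _, _ => []
  | op o e f, r => e.code r ++ f.code (r + e.size) ++
      [.arith o (r + e.size + f.size) (e.out r) (f.out (r + e.size))]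
  | load e, r => e.code r ++ [.load (r + e.size) (e.out r)]

theorem out_lt (e : Expr) {r : ℕ} (hr : 70 ≤ r) : e.out r < r + e.size := by
  cases e <;> simp only [out, size] <;> omega

theorem isLocal_of_mem_code (e : Expr) (r : ℕ) : ∀ I ∈ e.code r, I.IsLocal := by
  induction e generalizing r with
  | op o e f ihe ihf =>
    intro I hI
    simp only [code, List.mem_append, List.mem_singleton] at hI
    rcases hI with (hI | hI) | rfl
    · exact ihe _ I hI
    · exact ihf _ I hI
    · trivial
  | load e ihe =>
    intro I hI
    simp only [code, List.mem_append, List.mem_singleton] at hI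
    rcases hI with hI | rfl
    · exact ihe _ I hI
    · trivial
  | const v => intro I hI; obtain rfl := List.mem_singleton.1 hI; trivial
  | _ => intro I hI; simp [code] at hI

theorem execs_code (mem : ℕ → ℕ) (N : ℕ) (x y : Fin 8 → ℕ) (e : Expr) {r : ℕ} (hr : 70 ≤ r)
    {ρ : ℕ → ℕ} (h1 : ρ 1 = N) (hx : ∀ i : Fin 8, ρ (50 + i) = x i)
    (hy : ∀ i : Fin 8, ρ (60 + i) = y i) :
    (∀ q < r, execs mem (e.code r) ρ q = ρ q) ∧
      execs mem (e.code r) ρ (e.out r) = e.eval mem N x y := by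
  induction e generalizing r ρ with
  | const v =>
    refine ⟨fun q hq => ?_, ?_⟩
    · simp [code, execs_cons, execs_nil, Instr.exec, Function.update_of_ne hq.ne]
    · simp [code, execs_cons, execs_nil, Instr.exec, out, eval]
  | len => exact ⟨fun _ _ => rfl, h1⟩
  | src i => exact ⟨fun _ _ => rfl, hx i⟩
  | tgt i => exact ⟨fun _ _ => rfl, hy i⟩
  | op o e f ihe ihf =>
    obtain ⟨he, he'⟩ := ihe hr h1 hx hy
    set ρ₁ := execs mem (e.code r) ρ with hρ₁
    have hr' : 70 ≤ r + e.size := by omega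
    obtain ⟨hf, hf'⟩ := ihf hr' (ρ := ρ₁) (by rw [he _ (by omega), h1])
      (fun i => by rw [he _ (by omega), hx]) (fun i => by rw [he _ (by omega), hy])
    have h1 := e.out_lt hr
    have h2 := f.out_lt hr'
    simp only [code, execs_append, execs_cons, execs_nil, Instr.exec, ← hρ₁]
    refine ⟨fun q hq => ?_, ?_⟩
    · rw [Function.update_of_ne (by omega), hf _ (by omega), he _ hq]
    · rw [out, Function.update_self, hf', hf _ h1, he', eval]
  | load e ihe =>
    obtain ⟨he, he'⟩ := ihe hr h1 hx hy
    simp only [code, execs_append, execs_cons, execs_nil, Instr.exec]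
    refine ⟨fun q hq => ?_, ?_⟩
    · rw [Function.update_of_ne (by omega), he _ hq]
    · rw [out, Function.update_self, he', eval]

/-- The value of the expression is less than `X ^ e.deg`, if the digits are less than `X ^ 26` and
all words of the memory are less than `X`. -/
def deg : Expr → ℕ
  | const v => v
  | len => 1
  | src _ | tgt _ => 26
  | op o e f => o.exp e.deg f.deg
  | load _ => 1

/-- Word sizes of the registers that are used by the code of the expression. -/
def sizes : Expr → List ℕ
  | const v => [v]
  | len | src _ | tgt _ => []
  | op o e f => e.sizes ++ f.sizes ++ [o.exp e.deg f.deg]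
  | load e => e.sizes ++ [1]

theorem length_sizes (e : Expr) : e.sizes.length = e.size := by
  induction e with
  | op o e f ihe ihf => simp [sizes, size, ihe, ihf, add_assoc]
  | load e ihe => simp [sizes, size, ihe]
  | _ => rfl

theorem fits_code {Γ : ℕ → ℕ} (h1 : Γ 1 = 1) (hx : ∀ i : Fin 8, Γ (50 + i) = 26)
    (hy : ∀ i : Fin 8, Γ (60 + i) = 26) (e : Expr) {r : ℕ} (hr : 70 ≤ r)
    (h : ∀ j < e.size, e.sizes[j]? = some (Γ (r + j))) :
    Γ (e.out r) = e.deg ∧ ∀ I ∈ e.code r, Instr.Fits Γ I := by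
  induction e generalizing r with
  | const v =>
    have := h 0 (by simp [size])
    simp only [sizes, List.getElem?_cons_zero, Option.some.injEq, add_zero] at this
    refine ⟨this.symm, fun I hI => ?_⟩
    obtain rfl := List.mem_singleton.1 hI
    exact ⟨by omega, this.le⟩
  | len => exact ⟨h1, fun I hI => by simp [code] at hI⟩
  | src i => exact ⟨hx i, fun I hI => by simp [code] at hI⟩
  | tgt i => exact ⟨hy i, fun I hI => by simp [code] at hI⟩
  | op o e f ihe ihf =>
    simp only [size, sizes] at h
    obtain ⟨he, he'⟩ := ihe hr fun j hj => by
      rw [← h j (by omega), List.append_assoc, List.getElem?_append_left (by rwa [length_sizes])]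
    obtain ⟨hf, hf'⟩ := ihf (r := r + e.size) (by omega) fun j hj => by
      rw [add_assoc, ← h (e.size + j) (by omega), List.append_assoc,
        List.getElem?_append_right (by rw [length_sizes]; omega), length_sizes,
        Nat.add_sub_cancel_left, List.getElem?_append_left (by rwa [length_sizes])]
    have ho := h (e.size + f.size) (by omega)
    rw [List.getElem?_append_right (by simp [length_sizes])] at ho
    simp only [List.length_append, length_sizes, Nat.sub_self, List.getElem?_cons_zero,
      Option.some.injEq, ← add_assoc] at ho
    refine ⟨ho.symm, fun I hI => ?_⟩
    simp only [code, List.mem_append, List.mem_singleton] at hI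
    rcases hI with (hI | hI) | rfl
    · exact he' I hI
    · exact hf' I hI
    · exact ⟨by omega, by rw [he, hf, ho]⟩
  | load e ihe =>
    simp only [size, sizes] at h
    obtain ⟨-, he'⟩ := ihe hr fun j hj => by
      rw [← h j (by omega), List.getElem?_append_left (by rwa [length_sizes])]
    have ho := h e.size (by omega)
    rw [List.getElem?_append_right (by simp [length_sizes])] at ho
    simp only [length_sizes, Nat.sub_self, List.getElem?_cons_zero, Option.some.injEq] at ho
    refine ⟨ho.symm, fun I hI => ?_⟩
    simp only [code, List.mem_append, List.mem_singleton] at hI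
    rcases hI with hI | rfl
    · exact he' I hI
    · exact ⟨by omega, ho.le⟩

end Expr

end PRAM

/-! ### Walks -/

/-- A shortest walk visits no vertex twice. -/
theorem Relation.ReflTransGen.exists_injOn_walk {V : Type*} {r : V → V → Prop} {a b : V}
    (h : Relation.ReflTransGen r a b) :
    ∃ (l : ℕ) (f : ℕ → V), f 0 = a ∧ f l = b ∧ (∀ i < l, r (f i) (f (i + 1))) ∧
      Set.InjOn f (Set.Iic l) := by
  classical
  have hex : ∃ (l : ℕ) (f : ℕ → V), f 0 = a ∧ f l = b ∧ ∀ i < l, r (f i) (f (i + 1)) := by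
    induction h with
    | refl => exact ⟨0, fun _ => a, rfl, rfl, fun i hi => by omega⟩
    | @tail c d _ hcd ih =>
      obtain ⟨l, f, h0, hl, hf⟩ := ih
      refine ⟨l + 1, fun i => if i ≤ l then f i else d, by simp [h0], by simp, fun i hi => ?_⟩
      rcases Nat.lt_succ_iff_lt_or_eq.1 hi with h | rfl
      · simpa [h.le, Nat.succ_le_of_lt h] using hf i h
      · simpa [hl] using hcd
  obtain ⟨f, h0, hl, hf⟩ := Nat.find_spec hex
  refine ⟨Nat.find hex, f, h0, hl, hf, ?_⟩
  set l := Nat.find hex with hldef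
  have key : ∀ i j, i < j → j ≤ l → f i ≠ f j := by
    intro i j hij hj heq
    -- cutting out the part between two visits of a vertex gives a shorter walk
    refine Nat.find_min hex (m := l - (j - i)) (by omega)
      ⟨fun q => if q ≤ i then f q else f (q + (j - i)), by simp [h0], ?_, fun q hq => ?_⟩
    · dsimp only
      split_ifs with h
      · have h1 : j = l := by omega
        have h2 : l - (j - i) = i := by omega
        rw [h2, heq, h1, hl]
      · rw [Nat.sub_add_cancel (by omega), hl]
    · rcases lt_trichotomy q i with h | rfl | h
      · simpa [h.le, Nat.succ_le_of_lt h] using hf q (by omega)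
      · have := hf j (by omega)
        simp only [le_refl, if_true, if_neg (Nat.not_succ_le_self q)]
        rw [heq, show q + 1 + (j - q) = j + 1 by omega]
        exact this
      · have := hf (q + (j - i)) (by omega)
        simp only [if_neg (show ¬ q ≤ i by omega), if_neg (show ¬ q + 1 ≤ i by omega)]
        rw [show q + 1 + (j - i) = q + (j - i) + 1 by omega]
        exact this
  intro i hi j hj heq
  rcases lt_trichotomy i j with h | h | h
  · exact absurd heq (key i j h hj)
  · exact h
  · exact absurd heq.symm (key j i h hi)

/-! ### Transitive closure by a synchronous monotone circuit -/

namespace ReachCircuit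

/-- Number of the gate `m` of the pair `(a, b)`, where `b < Y` and `m < C`. -/
def cell (Y C a b m : ℕ) : ℕ := (a * Y + b) * C + m

/-- First input of the gate `i`. -/
def in₁ (Y C i : ℕ) : ℕ :=
  if i % C < Y then i + i % C else cell Y C (i / C / Y) (i % C % Y) 1

/-- Second input of the gate `i`. -/
def in₂ (Y C i : ℕ) : ℕ :=
  if i % C < Y then i + i % C + 1 else cell Y C (i % C % Y) (i / C % Y) 1

/-- State of the gates after `t` steps. For each pair `(a, b)` of vertices below `Y` the gates
`1 ≤ m < 2 * Y` form a binary tree with the root `1` in which the children of `m` are `2 * m` and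
`2 * m + 1`. The root tells whether `b` is known to be reachable from `a`; the leaf `Y + k` tells
whether this is known through the vertex `k`. A gate that is on stays on. The root does
not depend on the gates `0` and `m ≥ 2 * Y`, which exist so that the gates of all pairs are numbered
without gaps. -/
def gate (Y C : ℕ) (r : ℕ → ℕ → Prop) : ℕ → ℕ → Prop
  | 0, i => i % C = 1 ∧ r (i / C / Y) (i / C % Y)
  | t + 1, i => gate Y C r t i ∨
      if i % C < Y then gate Y C r t (in₁ Y C i) ∨ gate Y C r t (in₂ Y C i)
      else gate Y C r t (in₁ Y C i) ∧ gate Y C r t (in₂ Y C i)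

variable {Y C : ℕ} {r : ℕ → ℕ → Prop}

theorem cell_mod {a b m : ℕ} (hm : m < C) : cell Y C a b m % C = m := by
  rw [cell, Nat.mul_add_mod', Nat.mod_eq_of_lt hm]

theorem cell_div {a b m : ℕ} (hm : m < C) : cell Y C a b m / C = a * Y + b := by
  have hC : 0 < C := by omega
  rw [cell, mul_comm, Nat.mul_add_div hC, Nat.div_eq_of_lt hm, add_zero]

theorem cell_src {a b m : ℕ} (hm : m < C) (hb : b < Y) : cell Y C a b m / C / Y = a := by
  rw [cell_div hm, mul_comm, Nat.mul_add_div (by omega), Nat.div_eq_of_lt hb, add_zero]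

theorem cell_tgt {a b m : ℕ} (hm : m < C) (hb : b < Y) : cell Y C a b m / C % Y = b := by
  rw [cell_div hm, mul_comm, Nat.mul_add_mod, Nat.mod_eq_of_lt hb]

theorem cell_lt {a b m : ℕ} (ha : a < Y) (hb : b < Y) (hm : m < C) :
    cell Y C a b m < Y * Y * C := by
  have h1 : a * Y + b + 1 ≤ Y * Y := by nlinarith
  have h2 : (a * Y + b + 1) * C ≤ Y * Y * C := Nat.mul_le_mul_right C h1
  rw [cell]
  nlinarith

theorem cell_eta (i : ℕ) : cell Y C (i / C / Y) (i / C % Y) (i % C) = i := by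
  rw [cell, Nat.div_add_mod' , Nat.div_add_mod']

theorem in₁_lt (hY : 0 < Y) (hC : 2 * Y ≤ C) {i : ℕ} (hi : i < Y * Y * C) :
    in₁ Y C i < Y * Y * C := by
  have ha : i / C / Y < Y :=
    Nat.div_lt_of_lt_mul (Nat.div_lt_of_lt_mul (by rwa [mul_comm]))
  have hb : i / C % Y < Y := Nat.mod_lt _ hY
  rw [in₁]
  split_ifs with h
  · conv_lhs => enter [1]; rw [← cell_eta (Y := Y) (C := C) i]
    have := cell_lt (m := i % C + i % C) ha hb (show _ < C by omega)
    rwa [cell, ← add_assoc] at this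
  · exact cell_lt ha (Nat.mod_lt _ hY) (by omega)

theorem in₂_lt (hY : 0 < Y) (hC : 2 * Y ≤ C) {i : ℕ} (hi : i < Y * Y * C) :
    in₂ Y C i < Y * Y * C := by
  have ha : i / C / Y < Y :=
    Nat.div_lt_of_lt_mul (Nat.div_lt_of_lt_mul (by rwa [mul_comm]))
  have hb : i / C % Y < Y := Nat.mod_lt _ hY
  rw [in₂]
  split_ifs with h
  · conv_lhs => enter [1, 1]; rw [← cell_eta (Y := Y) (C := C) i]
    have := cell_lt (m := i % C + i % C + 1) ha hb (show _ < C by omega)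
    rwa [cell, ← add_assoc, ← add_assoc] at this
  · exact cell_lt (Nat.mod_lt _ hY) hb (by omega)

theorem in₁_of_lt {a b m : ℕ} (hm : m < Y) (hC : 2 * Y ≤ C) :
    in₁ Y C (cell Y C a b m) = cell Y C a b (2 * m) := by
  rw [in₁, cell_mod (by omega), if_pos hm]
  simp only [cell]; ring

theorem in₂_of_lt {a b m : ℕ} (hm : m < Y) (hC : 2 * Y ≤ C) :
    in₂ Y C (cell Y C a b m) = cell Y C a b (2 * m + 1) := by
  rw [in₂, cell_mod (by omega), if_pos hm]
  simp only [cell]; ring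

theorem transGen_of_gate (hY : 0 < Y) (hC : 2 * Y ≤ C) {t i : ℕ} (h : gate Y C r t i) :
    Relation.TransGen r (i / C / Y) (i / C % Y) := by
  induction t generalizing i with
  | zero => exact .single h.2
  | succ t ih =>
    rcases h with h | h
    · exact ih h
    have hb : i / C % Y < Y := Nat.mod_lt _ hY
    have hk : i % C % Y < Y := Nat.mod_lt _ hY
    split_ifs at h with hm
    · rw [← cell_eta (Y := Y) (C := C) i, in₁_of_lt hm hC, in₂_of_lt hm hC] at h
      rcases h with h | h
      · have := ih h
        rwa [cell_src (by omega) hb, cell_tgt (by omega) hb] at this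
      · have := ih h
        rwa [cell_src (by omega) hb, cell_tgt (by omega) hb] at this
    · obtain ⟨h1, h2⟩ := h
      rw [in₁, if_neg hm] at h1
      rw [in₂, if_neg hm] at h2
      have h1 := ih h1
      have h2 := ih h2
      rw [cell_src (by omega) hk, cell_tgt (by omega) hk] at h1
      rw [cell_src (by omega) hb, cell_tgt (by omega) hb] at h2
      exact h1.trans h2

theorem gate_mono {t t' i : ℕ} (htt : t ≤ t') (h : gate Y C r t i) : gate Y C r t' i := by
  induction htt with
  | refl => exact h
  | step _ ih => exact Or.inl ih

theorem gate_root (hC : 2 * Y ≤ C) {a b m t : ℕ} (hm : 1 ≤ m) (hm' : m < 2 * Y)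
    (h : gate Y C r t (cell Y C a b m)) : gate Y C r (t + Nat.log 2 m) (cell Y C a b 1) := by
  induction m using Nat.strong_induction_on generalizing t with
  | _ m ih =>
    rcases hm.eq_or_lt with rfl | h1
    · simpa using h
    · have hp : gate Y C r (t + 1) (cell Y C a b (m / 2)) := by
        have hlt : m / 2 < Y := by omega
        refine Or.inr ?_
        rw [cell_mod (by omega), if_pos hlt, in₁_of_lt hlt hC, in₂_of_lt hlt hC]
        rcases Nat.mod_two_eq_zero_or_one m with h2 | h2
        · left; rwa [show 2 * (m / 2) = m by omega]
        · right; rwa [show 2 * (m / 2) + 1 = m by omega]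
      have := ih (m / 2) (by omega) (by omega) (by omega) hp
      rwa [Nat.log_div_base, show t + 1 + (Nat.log 2 m - 1) = t + Nat.log 2 m by
        have := Nat.log_pos (b := 2) one_lt_two h1; omega] at this

/-- Doubling the length of the walks takes the time to climb the tree. -/
theorem gate_of_walk (hC : 2 * Y ≤ C) (hr : ∀ a b, r a b → a < Y ∧ b < Y) (s : ℕ) {l : ℕ}
    (hl : 1 ≤ l) (hl' : l ≤ 2 ^ s) {f : ℕ → ℕ} (hf : ∀ i < l, r (f i) (f (i + 1))) :
    gate Y C r (s * (Nat.log 2 C + 1)) (cell Y C (f 0) (f l) 1) := by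
  have one : ∀ {f : ℕ → ℕ}, r (f 0) (f 1) → ∀ t, gate Y C r t (cell Y C (f 0) (f 1) 1) := by
    intro f h t
    obtain ⟨ha, hb⟩ := hr _ _ h
    refine gate_mono (Nat.zero_le t) ⟨cell_mod (by omega), ?_⟩
    rwa [cell_src (by omega) hb, cell_tgt (by omega) hb]
  induction s generalizing l f with
  | zero =>
    obtain rfl : l = 1 := by simp at hl'; omega
    exact one (hf 0 (by omega)) _
  | succ s ih =>
    rcases hl.eq_or_lt with rfl | h1
    · exact one (hf 0 (by omega)) _
    have hk : f (l / 2) < Y := (hr _ _ (hf (l / 2) (by omega))).1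
    have hb : f l < Y := by
      have := (hr _ _ (hf (l - 1) (by omega))).2
      rwa [Nat.sub_add_cancel hl] at this
    have g1 := ih (l := l / 2) (f := f) (by omega) (by rw [pow_succ] at hl'; omega)
      (fun i hi => hf i (by omega))
    have g2 := ih (l := l - l / 2) (f := fun i => f (l / 2 + i)) (by omega)
      (by rw [pow_succ] at hl'; omega) (fun i hi => hf (l / 2 + i) (by omega))
    simp only [add_zero, show l / 2 + (l - l / 2) = l by omega] at g2
    have g3 : gate Y C r (s * (Nat.log 2 C + 1) + 1) (cell Y C (f 0) (f l) (Y + f (l / 2))) := by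
      refine Or.inr ?_
      rw [cell_mod (by omega), if_neg (by omega)]
      have hmod : (Y + f (l / 2)) % Y = f (l / 2) := by
        rw [Nat.add_mod_left, Nat.mod_eq_of_lt hk]
      rw [in₁, in₂, cell_mod (by omega), if_neg (by omega), if_neg (by omega),
        cell_src (by omega) hb, cell_tgt (by omega) hb, hmod]
      exact ⟨g1, g2⟩
    refine gate_mono ?_ (gate_root hC (by omega) (by omega) g3)
    have : Nat.log 2 (Y + f (l / 2)) ≤ Nat.log 2 C := Nat.log_mono_right (by omega)
    rw [add_mul]
    omega

/-- The circuit computes reachability of `1` from `0` within the number of steps for which the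
program runs it. -/
theorem gate_iff_reach (hY : 2 ≤ Y) (hC : 2 * Y ≤ C) (hr : ∀ a b, r a b → a < Y ∧ b < Y) {t : ℕ}
    (ht : Nat.log 2 C * (Nat.log 2 C + 1) ≤ t) :
    gate Y C r t (cell Y C 0 1 1) ↔ Relation.ReflTransGen r 0 1 := by
  constructor
  · intro h
    have := transGen_of_gate (by omega) hC h
    rw [cell_src (by omega) (by omega), cell_tgt (by omega) (by omega)] at this
    exact this.to_reflTransGen
  · intro h
    obtain ⟨l, f, h0, hl, hf, hinj⟩ := h.exists_injOn_walk
    have hl1 : 1 ≤ l := by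
      rcases Nat.eq_zero_or_pos l with rfl | h
      · omega
      · exact h
    have hmaps : ∀ i ∈ Finset.range (l + 1), f i ∈ Finset.range Y := by
      intro i hi
      rw [Finset.mem_range] at hi ⊢
      rcases Nat.lt_succ_iff_lt_or_eq.1 hi with h | rfl
      · exact (hr _ _ (hf i h)).1
      · omega
    have hcard := Finset.card_le_card_of_injOn f hmaps (fun i hi j hj => hinj
      (by simpa [Nat.lt_succ_iff] using hi) (by simpa [Nat.lt_succ_iff] using hj))
    rw [Finset.card_range, Finset.card_range] at hcard
    have hL : Y ≤ 2 ^ Nat.log 2 C := by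
      have := Nat.lt_pow_succ_log_self one_lt_two C
      rw [pow_succ] at this
      omega
    have := gate_of_walk hC hr (Nat.log 2 C) hl1 (by omega) hf
    rw [h0, hl] at this
    exact gate_mono ht this

end ReachCircuit

namespace PRAM

open ReachCircuit

variable {p : ℕ}

/-! ### A program for reachability

Registers: `0` number `i` of the processor, `1` length `N` of the input, `2`, `3`, `4` the constants
`0`, `1`, `2`, `5` the base `X = N + 2`, `8` the number `Y = X ^ 8` of vertices, `9` the number
`C = X ^ 9` of gates per pair of vertices, `10` the gate `m` of the pair `(a, b)` of vertices in the
registers `13` and `12` for which the processor is responsible, `16` and `17` the counters, `20` is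
`0` or `1` for an `or`-gate or an `and`-gate, `28` and `36` the addresses of the inputs of the gate,
`37` the state of the gate, from `50` and from `60` on the digits of `a` and `b`. -/

/-- The instructions that put the last `k` base-`X` digits of register `s` into the registers from
`d` on, and divide register `s` by `X ^ k`; here `X` is the content of register `5`. -/
def digitCode (s d : ℕ) : ℕ → List Instr
  | 0 => []
  | k + 1 => digitCode s d k ++ [.arith .mod (d + k) s 5, .arith .div s s 5]

/-- Computes the constants, the pair of vertices, the gate and its inputs, and starts the
counters. -/
def setupCode : List Instr :=
  [.const 3 1, .const 4 2, .arith .add 5 1 4, .arith .mul 6 5 5, .arith .mul 7 6 6,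
   .arith .mul 8 7 7, .arith .mul 9 8 5, .arith .mod 10 0 9, .arith .div 11 0 9,
   .arith .mod 12 11 8, .arith .div 13 11 8, .arith .add 14 13 2, .arith .add 15 12 2,
   .arith .add 16 9 2, .arith .add 17 9 2, .arith .mod 18 10 8, .arith .lt 19 10 8,
   .arith .eq 20 19 2, .arith .mul 21 13 8, .arith .add 22 21 18, .arith .mul 23 22 9,
   .arith .add 24 23 3, .arith .mul 25 24 20, .arith .add 26 0 10, .arith .mul 27 26 19,
   .arith .add 28 25 27, .arith .mul 29 18 8, .arith .add 30 29 12, .arith .mul 31 30 9,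
   .arith .add 32 31 3, .arith .mul 33 32 20, .arith .add 34 26 3, .arith .mul 35 34 19,
   .arith .add 36 33 35]

/-- Puts the initial state of the gate into register `37`, if register `q` tells whether there is an
arc from `a` to `b`. -/
def initCode (q : ℕ) : List Instr :=
  [.arith .lt 38 2 q, .arith .eq 39 10 3, .arith .mul 40 38 39, .arith .lt 37 2 40]

/-- One step of the circuit, after the states of the gates have been stored, and of the counters:
the second counter is halved; when it reaches `0`, it starts again from `C`, and the first counter
is halved. Register `68` tells whether the first counter has reached `0`. The new value `x ≤ C` of the
second counter is computed as `C - (C - x)`, for which `Instr.Fits` needs no larger exponent than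
for `C`; so the exponents do not grow from one iteration to the next. -/
def updateCode : List Instr :=
  [.load 41 28, .load 42 36, .arith .add 43 41 42, .arith .lt 44 20 43, .arith .add 45 44 37,
   .arith .lt 37 2 45,
   .arith .div 46 17 4, .arith .eq 47 46 2, .arith .mul 48 47 9, .arith .add 49 46 48,
   .arith .sub 58 9 49, .arith .sub 17 9 58, .arith .add 59 3 47, .arith .div 16 16 59,
   .arith .eq 68 16 2]

/-- Reads the state of the root of the pair `(0, 1)` and negates it. -/
def answerCode : List Instr :=
  [.arith .add 69 9 3, .load 41 69, .arith .eq 37 41 2]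

/-- All that precedes the loop. -/
def startCode (e : Expr) : List Instr :=
  setupCode ++ digitCode 14 50 8 ++ digitCode 15 60 8 ++ e.code 70 ++ initCode (e.out 70)

/-- The program decides whether `1` is not reachable from `0` in the graph with the arcs described
by `e`. -/
def reachProgram (e : Expr) : Program :=
  startCode e ++ [.store 0 37] ++ updateCode ++ [.jumpIfZero 68 (startCode e).length] ++
    answerCode ++ [.store 0 37]

/-- Word sizes of the registers: the bounds of `Instr.Fits`, worked out for the registers
`0, …, 69` one after the other, and the word sizes for the code of `e`. -/
def reachSizes (e : Expr) : List ℕ :=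
  [25, 1, 1, 1, 2, 3, 6, 12, 24, 27,
   25, 25, 25, 25, 26, 26, 28, 28, 25, 1,
   1, 49, 50, 77, 78, 79, 26, 27, 80, 49,
   50, 77, 78, 79, 27, 28, 80, 1, 1, 1,
   2, 1, 1, 2, 1, 2, 28, 1, 28, 29,
   26, 26, 26, 26, 26, 26, 26, 26, 27, 2,
   26, 26, 26, 26, 26, 26, 26, 26, 1, 28] ++ e.sizes

theorem fits_reachProgram (e : Expr) :
    ∀ I ∈ reachProgram e, Instr.Fits (fun r => (reachSizes e).getD r 1) I := by
  intro I hI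
  simp only [reachProgram, startCode, List.mem_append] at hI
  rcases hI with (((((((((h | h) | h) | h) | h) | h) | h) | h) | h) | h)
  · exact of_decide_eq_true (p := ∀ I ∈ setupCode,
      Instr.Fits (fun r => (reachSizes e).getD r 1) I) rfl I h
  · exact of_decide_eq_true (p := ∀ I ∈ digitCode 14 50 8,
      Instr.Fits (fun r => (reachSizes e).getD r 1) I) rfl I h
  · exact of_decide_eq_true (p := ∀ I ∈ digitCode 15 60 8,
      Instr.Fits (fun r => (reachSizes e).getD r 1) I) rfl I h
  · refine (e.fits_code rfl (fun i => by fin_cases i <;> rfl) (fun i => by fin_cases i <;> rfl)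
      (le_refl 70) fun j hj => ?_).2 I h
    rw [← e.length_sizes] at hj
    rw [reachSizes, List.getD_append_right _ _ _ _ (by simp)]
    simp [hj]
  · exact of_decide_eq_true (p := ∀ I ∈ initCode (e.out 70),
      Instr.Fits (fun r => (reachSizes e).getD r 1) I) rfl I h
  · obtain rfl := List.mem_singleton.1 h
    exact ⟨rfl, le_rfl⟩
  · exact of_decide_eq_true (p := ∀ I ∈ updateCode,
      Instr.Fits (fun r => (reachSizes e).getD r 1) I) rfl I h
  · obtain rfl := List.mem_singleton.1 h
    trivial
  · exact of_decide_eq_true (p := ∀ I ∈ answerCode,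
      Instr.Fits (fun r => (reachSizes e).getD r 1) I) rfl I h
  · obtain rfl := List.mem_singleton.1 h
    exact ⟨rfl, le_rfl⟩

/-! ### Correctness of the parts of the program -/

theorem isLocal_of_mem_digitCode (s d k : ℕ) : ∀ I ∈ digitCode s d k, I.IsLocal := by
  induction k with
  | zero => intro I hI; simp [digitCode] at hI
  | succ k ih =>
    intro I hI
    simp only [digitCode, List.mem_append, List.mem_cons, List.not_mem_nil, or_false] at hI
    rcases hI with hI | rfl | rfl
    · exact ih I hI
    · trivial
    · trivial

theorem execs_digitCode (mem ρ : ℕ → ℕ) {s d : ℕ} (h5 : s ≠ 5) (hsd : s < d) (hd : 5 < d) (k : ℕ) :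
    (∀ i < k, execs mem (digitCode s d k) ρ (d + i) = ρ s / ρ 5 ^ i % ρ 5) ∧
      execs mem (digitCode s d k) ρ s = ρ s / ρ 5 ^ k ∧
      ∀ q, q ≠ s → (q < d ∨ d + k ≤ q) → execs mem (digitCode s d k) ρ q = ρ q := by
  induction k with
  | zero => exact ⟨fun i hi => by omega, by simp [digitCode, execs_nil], fun _ _ _ => rfl⟩
  | succ k ih =>
    obtain ⟨h1, h2, h3⟩ := ih
    have h4 := h3 5 h5.symm (Or.inl hd)
    simp only [digitCode, execs_append, execs_cons, execs_nil, Instr.exec, Op.eval]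
    set ρ' := execs mem (digitCode s d k) ρ
    refine ⟨fun i hi => ?_, ?_, fun q hq hq' => ?_⟩
    · rw [Function.update_of_ne (by omega)]
      rcases Nat.lt_succ_iff_lt_or_eq.1 hi with h | rfl
      · rw [Function.update_of_ne (by omega), h1 i h]
      · rw [Function.update_self, h2, h4]
    · rw [Function.update_self, Function.update_of_ne (by omega), Function.update_of_ne (by omega),
        h2, h4, Nat.div_div_eq_div_mul, pow_succ]
    · rw [Function.update_of_ne hq, Function.update_of_ne (by omega), h3 q hq (by omega)]

/-- The registers after the setup, for the processor with number `i`, which is the cell of the gate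
`i % C` of the pair `(i / C / Y, i / C % Y)`. -/
theorem execs_setupCode (mem ρ : ℕ → ℕ) (h2 : ρ 2 = 0) {X Y C i : ℕ} (hi : ρ 0 = i)
    (hX : X = ρ 1 + 2) (hY : Y = X ^ 8) (hC : C = X ^ 9) :
    let ρ' := execs mem setupCode ρ
    ρ' 0 = i ∧ ρ' 1 = ρ 1 ∧ ρ' 2 = 0 ∧ ρ' 3 = 1 ∧ ρ' 4 = 2 ∧ ρ' 5 = X ∧ ρ' 9 = C ∧
      ρ' 10 = i % C ∧ ρ' 14 = i / C / Y ∧ ρ' 15 = i / C % Y ∧ ρ' 16 = C ∧ ρ' 17 = C ∧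
      ρ' 20 = (if i % C < Y then 0 else 1) ∧ ρ' 28 = in₁ Y C i ∧ ρ' 36 = in₂ Y C i := by
  subst hi
  have hY' : X * X * (X * X) * (X * X * (X * X)) = Y := by rw [hY]; ring
  have hC' : Y * X = C := by rw [hC, hY]; ring
  simp only [setupCode, execs_cons, execs_nil, Instr.exec, Op.eval, Function.update_apply,
    Nat.reduceEqDiff, if_true, if_false, h2, ← hX, hY', hC', in₁, in₂, cell,
    OfNat.zero_ne_ofNat, OfNat.one_ne_ofNat, add_zero]
  refine ⟨trivial, trivial, trivial, trivial, trivial, trivial, trivial, trivial, trivial, trivial,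
    trivial, trivial, ?_⟩
  by_cases h : ρ 0 % C < Y
  · simp [h]
  · simp [h]

theorem execs_initCode (mem ρ : ℕ → ℕ) {q : ℕ} (h2 : ρ 2 = 0) (h3 : ρ 3 = 1) :
    execs mem (initCode q) ρ 37 = (if ρ q ≠ 0 ∧ ρ 10 = 1 then 1 else 0) ∧
      ∀ q' < 37, execs mem (initCode q) ρ q' = ρ q' := by
  simp only [initCode, execs_cons, execs_nil, Instr.exec, Op.eval]
  refine ⟨?_, fun q' hq' => ?_⟩
  · by_cases h : ρ q = 0 <;> by_cases h' : ρ 10 = 1 <;>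
      simp [h2, h3, h, h', Nat.pos_iff_ne_zero]
  · repeat rw [Function.update_of_ne (by omega)]

theorem execs_updateCode (mem ρ : ℕ → ℕ) {C : ℕ} (h2 : ρ 2 = 0) (h3 : ρ 3 = 1) (h4 : ρ 4 = 2)
    (h9 : ρ 9 = C) (h17 : ρ 17 ≤ C) :
    let ρ' := execs mem updateCode ρ
    ρ' 37 = (if ρ 37 ≠ 0 ∨ ρ 20 < mem (ρ 28) + mem (ρ 36) then 1 else 0) ∧
      ρ' 16 = (if ρ 17 / 2 = 0 then ρ 16 / 2 else ρ 16) ∧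
      ρ' 17 = (if ρ 17 / 2 = 0 then C else ρ 17 / 2) ∧
      ρ' 68 = (if ρ' 16 = 0 then 1 else 0) ∧
      ∀ q < 37, q ≠ 16 → q ≠ 17 → ρ' q = ρ q := by
  simp only [updateCode, execs_cons, execs_nil, Instr.exec, Op.eval]
  refine ⟨?_, ?_, ?_, ?_, fun q' hq' h h' => ?_⟩
  · by_cases h : ρ 37 = 0 <;> by_cases h' : ρ 20 < mem (ρ 28) + mem (ρ 36) <;>
      simp [h2, h, h', Nat.pos_iff_ne_zero]
  · by_cases h : ρ 17 / 2 = 0 <;> simp [h2, h3, h4, h]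
  · have h5 : ρ 17 / 2 ≤ C := by omega
    have h6 : C - (C - ρ 17 / 2) = ρ 17 / 2 := by omega
    by_cases h : ρ 17 / 2 = 0
    · simp [h2, h4, h9, h]
    · simp [h2, h4, h9, h, h6]
  · simp [h2]
  · repeat rw [Function.update_of_ne (by omega)]

/-! ### The loop -/

open Classical in
/-- Contents of the registers when the loop is entered, after `t` steps of the circuit. -/
structure LoopInv (r : ℕ → ℕ → Prop) (Y C t c₁ c₂ : ℕ) (ρ : Fin p → ℕ → ℕ) : Prop where
  id : ∀ i, ρ i 0 = i
  zero : ∀ i, ρ i 2 = 0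
  one : ∀ i, ρ i 3 = 1
  two : ∀ i, ρ i 4 = 2
  gates : ∀ i, ρ i 9 = C
  kind : ∀ i, ρ i 20 = if (i : ℕ) % C < Y then 0 else 1
  in₁ : ∀ i, ρ i 28 = in₁ Y C i
  in₂ : ∀ i, ρ i 36 = in₂ Y C i
  gate : ∀ i, ρ i 37 = if gate Y C r t i then 1 else 0
  outer : ∀ i, ρ i 16 = c₁
  inner : ∀ i, ρ i 17 = c₂

theorem getElem?_append_cons {α : Type*} {A B : List α} {I : α} {k : ℕ} (hk : k = A.length) :
    (A ++ I :: B)[k]? = some I := by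
  subst hk
  simp

/-- Number of steps of one iteration of the loop. -/
def loopLength : ℕ := 1 + updateCode.length + 1

open Classical in
theorem iterate_step_loop {r : ℕ → ℕ → Prop} {Y C t c₁ c₂ : ℕ} (hp : p = Y * Y * C) (hY : 0 < Y)
    (hC : 2 * Y ≤ C) (e : Expr) (hc₂ : c₂ ≤ C) {ρ : Fin p → ℕ → ℕ} (mem : ℕ → ℕ)
    (h : LoopInv r Y C t c₁ c₂ ρ) :
    ∃ (ρ' : Fin p → ℕ → ℕ) (mem' : ℕ → ℕ),
      (Config.step (reachProgram e))^[loopLength] (lock (startCode e).length ρ mem) =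
        lock (if (if c₂ / 2 = 0 then c₁ / 2 else c₁) = 0 then (startCode e).length + loopLength
          else (startCode e).length) ρ' mem' ∧
      LoopInv r Y C (t + 1) (if c₂ / 2 = 0 then c₁ / 2 else c₁)
        (if c₂ / 2 = 0 then C else c₂ / 2) ρ' ∧
      ∀ a < p, mem' a = if ReachCircuit.gate Y C r t a then 1 else 0 := by
  set mem' : ℕ → ℕ := fun a => if h : a < p then ρ ⟨a, h⟩ 37 else mem a with hmem'
  have hm : ∀ a < p, mem' a = if ReachCircuit.gate Y C r t a then 1 else 0 := by
    intro a ha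
    simp [hmem', ha, h.gate]
  have hu := fun i => execs_updateCode mem' (ρ i) (h.zero i) (h.one i) (h.two i) (h.gates i)
    (by rw [h.inner]; exact hc₂)
  refine ⟨fun i => execs mem' updateCode (ρ i), mem', ?_, ?_, hm⟩
  · have s1 := step_lock_store (P := reachProgram e) (k := (startCode e).length) (r := 37)
      (by simp [reachProgram]) h.id mem
    have s2 := iterate_step_lock_block (p := p) (startCode e ++ [.store 0 37]) updateCode
      ([.jumpIfZero 68 (startCode e).length] ++ answerCode ++ [.store 0 37])
      (by intro I hI; fin_cases hI <;> trivial) ρ mem'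
    have hP : startCode e ++ [.store 0 37] ++ updateCode ++
        ([.jumpIfZero 68 (startCode e).length] ++ answerCode ++ [.store 0 37]) =
          reachProgram e := by simp [reachProgram]
    rw [hP] at s2
    have s3 := step_lock_jump (P := reachProgram e)
      (k := (startCode e).length + 1 + updateCode.length) (r := 68) (l := (startCode e).length)
      (by rw [← hP]; exact getElem?_append_cons (by simp; omega))
      (x := if (if c₂ / 2 = 0 then c₁ / 2 else c₁) = 0 then 1 else 0)
      (ρ := fun i => execs mem' updateCode (ρ i))
      (fun i => by rw [(hu i).2.2.2.1, (hu i).2.1, h.inner, h.outer]) mem'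
    rw [loopLength, Nat.add_comm 1 updateCode.length, Function.iterate_succ_apply',
      Function.iterate_succ_apply, s1]
    simp only [List.length_append, List.length_singleton] at s2
    rw [s2, s3]
    generalize (if c₂ / 2 = 0 then c₁ / 2 else c₁) = c
    by_cases hc : c = 0
    · simp only [hc, if_true, one_ne_zero, if_false]
      congr 1
    · simp only [hc, if_true, if_false]
  · have hk : ∀ i, ∀ q < 37, q ≠ 16 → q ≠ 17 → execs mem' updateCode (ρ i) q = ρ i q :=
      fun i => (hu i).2.2.2.2
    refine ⟨fun i => ?_, fun i => ?_, fun i => ?_, fun i => ?_, fun i => ?_, fun i => ?_,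
      fun i => ?_, fun i => ?_, fun i => ?_, fun i => ?_, fun i => ?_⟩
    · rw [hk i _ (by omega) (by omega) (by omega), h.id]
    · rw [hk i _ (by omega) (by omega) (by omega), h.zero]
    · rw [hk i _ (by omega) (by omega) (by omega), h.one]
    · rw [hk i _ (by omega) (by omega) (by omega), h.two]
    · rw [hk i _ (by omega) (by omega) (by omega), h.gates]
    · rw [hk i _ (by omega) (by omega) (by omega), h.kind]
    · rw [hk i _ (by omega) (by omega) (by omega), h.in₁]
    · rw [hk i _ (by omega) (by omega) (by omega), h.in₂]
    · rw [(hu i).1, h.gate, h.kind, h.in₁, h.in₂,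
        hm _ (lt_of_lt_of_eq (in₁_lt hY hC (lt_of_lt_of_eq i.2 hp)) hp.symm),
        hm _ (lt_of_lt_of_eq (in₂_lt hY hC (lt_of_lt_of_eq i.2 hp)) hp.symm)]
      simp only [ReachCircuit.gate]
      by_cases h0 : ReachCircuit.gate Y C r t i <;>
      by_cases h1 : ReachCircuit.gate Y C r t (ReachCircuit.in₁ Y C i) <;>
      by_cases h2 : ReachCircuit.gate Y C r t (ReachCircuit.in₂ Y C i) <;>
      by_cases h3 : (i : ℕ) % C < Y <;> simp [h0, h1, h2, h3]
    · rw [(hu i).2.1, h.inner, h.outer]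
    · rw [(hu i).2.2.1, h.inner]

open Classical in
/-- The loop runs `Nat.log 2 c₁ * (Nat.log 2 C + 1) + Nat.log 2 c₂ + 1` times, which is the number
of times the counters can be updated before the first one becomes `0`. -/
theorem iterate_step_loops {r : ℕ → ℕ → Prop} {Y C t c₁ c₂ : ℕ} (hp : p = Y * Y * C) (hY : 0 < Y)
    (hC : 2 * Y ≤ C) (e : Expr) {ρ : Fin p → ℕ → ℕ} (mem : ℕ → ℕ)
    (h : LoopInv r Y C t c₁ c₂ ρ) (hc₁ : 0 < c₁) (hc₂ : 0 < c₂) (hc₂' : c₂ ≤ C) {k : ℕ}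
    (hk : k = Nat.log 2 c₁ * (Nat.log 2 C + 1) + Nat.log 2 c₂) :
    ∃ (ρ' : Fin p → ℕ → ℕ) (mem' : ℕ → ℕ) (c₁' c₂' : ℕ),
      (Config.step (reachProgram e))^[(k + 1) * loopLength] (lock (startCode e).length ρ mem) =
        lock ((startCode e).length + loopLength) ρ' mem' ∧
      LoopInv r Y C (t + k + 1) c₁' c₂' ρ' ∧
      ∀ a < p, mem' a = if ReachCircuit.gate Y C r (t + k) a then 1 else 0 := by
  induction k generalizing t c₁ c₂ ρ mem with
  | zero =>
    obtain ⟨ρ', mem', h1, h2, h3⟩ := iterate_step_loop hp hY hC e hc₂' mem h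
    have hlog2 : Nat.log 2 c₂ = 0 := by omega
    have hlog1 : Nat.log 2 c₁ = 0 := by
      have : Nat.log 2 c₁ * (Nat.log 2 C + 1) = 0 := by omega
      simpa using this
    have e1 : c₁ / 2 = 0 := by
      rw [Nat.log_eq_zero_iff] at hlog1
      omega
    have e2 : c₂ / 2 = 0 := by
      rw [Nat.log_eq_zero_iff] at hlog2
      omega
    rw [if_pos e2, if_pos e1] at h1
    exact ⟨ρ', mem', _, _, by simpa using h1, h2, h3⟩
  | succ k ih =>
    obtain ⟨ρ', mem', h1, h2, h3⟩ := iterate_step_loop hp hY hC e hc₂' mem h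
    rw [add_mul (k + 1), one_mul, Function.iterate_add_apply]
    have hd1 := Nat.log_div_base 2 c₁
    have hd2 := Nat.log_div_base 2 c₂
    by_cases e2 : c₂ / 2 = 0
    · have hlog2 : Nat.log 2 c₂ = 0 := by rw [Nat.log_eq_zero_iff]; omega
      have hlog1 : Nat.log 2 c₁ ≠ 0 := by
        intro h0
        rw [h0, hlog2] at hk
        omega
      have e1 : c₁ / 2 ≠ 0 := by
        intro h0
        apply hlog1
        rw [Nat.log_eq_zero_iff]
        omega
      rw [if_pos e2, if_neg e1] at h1
      rw [if_pos e2, if_pos e2] at h2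
      obtain ⟨ρ'', mem'', c₁', c₂', g1, g2, g3⟩ := ih mem' h2 (by omega) (by omega) le_rfl (by
        rw [hd1]
        obtain ⟨j, hj⟩ := Nat.exists_eq_succ_of_ne_zero hlog1
        rw [hj] at hk ⊢
        rw [Nat.succ_mul, hlog2] at hk
        rw [Nat.succ_sub_one]
        omega)
      refine ⟨ρ'', mem'', c₁', c₂', by rw [h1, g1], ?_, ?_⟩
      · rwa [show t + (k + 1) + 1 = t + 1 + k + 1 by omega]
      · rwa [show t + (k + 1) = t + 1 + k by omega]
    · have hlog2 : Nat.log 2 c₂ ≠ 0 := by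
        intro h0
        rw [Nat.log_eq_zero_iff] at h0
        omega
      rw [if_neg e2, if_neg hc₁.ne'] at h1
      rw [if_neg e2, if_neg e2] at h2
      obtain ⟨ρ'', mem'', c₁', c₂', g1, g2, g3⟩ := ih mem' h2 hc₁ (by omega) (by omega) (by
        rw [hd2]
        omega)
      refine ⟨ρ'', mem'', c₁', c₂', by rw [h1, g1], ?_, ?_⟩
      · rwa [show t + (k + 1) + 1 = t + 1 + k + 1 by omega]
      · rwa [show t + (k + 1) = t + 1 + k by omega]

/-! ### Correctness of the program -/

/-- The memory that holds the bit string `x` and then zeros. -/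
def inputMem (x : List Bool) (a : ℕ) : ℕ := if x[a]? = some true then 1 else 0

/-- The `i`-th digit of `a` to the base `X`. -/
def digit (X a : ℕ) (i : Fin 8) : ℕ := a / X ^ (i : ℕ) % X

/-- The graph on the numbers of at most eight digits to the base `x.length + 2` with the arcs
described by `e`. -/
def Expr.Arc (e : Expr) (x : List Bool) (a b : ℕ) : Prop :=
  a < (x.length + 2) ^ 8 ∧ b < (x.length + 2) ^ 8 ∧
    e.eval (inputMem x) x.length (digit (x.length + 2) a) (digit (x.length + 2) b) ≠ 0

theorem Expr.arc_iff {e : Expr} {x : List Bool} {a b X : ℕ} (hX : X = x.length + 2) :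
    e.Arc x a b ↔ a < X ^ 8 ∧ b < X ^ 8 ∧
      e.eval (inputMem x) x.length (digit X a) (digit X b) ≠ 0 := by
  subst hX
  rfl

open Classical in
theorem iterate_step_start (e : Expr) (x : List Bool) {X Y C : ℕ} (hX : X = x.length + 2)
    (hY : Y = X ^ 8) (hC : C = X ^ 9) (hp : p = Y * Y * C) :
    ∃ ρ : Fin p → ℕ → ℕ, (Config.step (reachProgram e))^[(startCode e).length] (init p x) =
        lock (startCode e).length ρ (inputMem x) ∧ LoopInv (e.Arc x) Y C 0 C C ρ := by
  set ρ₀ : Fin p → ℕ → ℕ :=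
    fun i r => if r = 0 then (i : ℕ) else if r = 1 then x.length else 0 with hρ₀
  have hlocal : ∀ I ∈ startCode e, I.IsLocal := by
    intro I hI
    simp only [startCode, List.mem_append] at hI
    rcases hI with (((hI | hI) | hI) | hI) | hI
    · fin_cases hI <;> trivial
    · exact isLocal_of_mem_digitCode _ _ _ I hI
    · exact isLocal_of_mem_digitCode _ _ _ I hI
    · exact e.isLocal_of_mem_code _ I hI
    · fin_cases hI <;> trivial
  have s1 := iterate_step_lock_block (p := p) [] (startCode e)
    ([.store 0 37] ++ updateCode ++ [.jumpIfZero 68 (startCode e).length] ++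
      answerCode ++ [.store 0 37]) hlocal ρ₀ (inputMem x)
  refine ⟨fun i => execs (inputMem x) (startCode e) (ρ₀ i), ?_, ?_⟩
  · rw [show init p x = lock 0 ρ₀ (inputMem x) from rfl]
    simpa [reachProgram] using s1
  have hX0 : 0 < X := by omega
  have hY0 : 0 < Y := hY ▸ Nat.pow_pos hX0
  have key : ∀ i : Fin p, ∀ r', execs (inputMem x) (startCode e) (ρ₀ i) = r' →
      ∃ ρ₁, ρ₁ = execs (inputMem x) setupCode (ρ₀ i) ∧
      (∀ q < 37, q ≠ 14 → q ≠ 15 → r' q = ρ₁ q) ∧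
      r' 37 = if (e.Arc x (i / C / Y) (i / C % Y) ∧ ρ₁ 10 = 1) then 1 else 0 := by
    rintro i r' rfl
    obtain ⟨-, g1, g2, g3, -, g5, -, -, g14, g15, -⟩ :=
      execs_setupCode (inputMem x) (ρ₀ i) (by simp [hρ₀]) (i := i) (by simp [hρ₀])
        (X := X) (by simp [hρ₀, hX]) hY hC
    refine ⟨_, rfl, ?_⟩
    simp only [startCode, execs_append]
    set ρ₁ := execs (inputMem x) setupCode (ρ₀ i)
    obtain ⟨a1, -, a3⟩ := execs_digitCode (inputMem x) ρ₁ (s := 14) (d := 50) (by omega) (by omega)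
      (by omega) 8
    set ρ₂ := execs (inputMem x) (digitCode 14 50 8) ρ₁
    obtain ⟨b1, -, b3⟩ := execs_digitCode (inputMem x) ρ₂ (s := 15) (d := 60) (by omega) (by omega)
      (by omega) 8
    set ρ₃ := execs (inputMem x) (digitCode 15 60 8) ρ₂
    have k3 : ∀ q, q ≠ 14 → q ≠ 15 → q < 50 → ρ₃ q = ρ₁ q := fun q h h' h'' => by
      rw [b3 q h' (by omega), a3 q h (by omega)]
    obtain ⟨c1, c2⟩ := Expr.execs_code (inputMem x) x.length (digit X (i / C / Y))
      (digit X (i / C % Y)) e (r := 70) le_rfl (ρ := ρ₃)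
      (by rw [k3 1 (by omega) (by omega) (by omega), g1]; simp [hρ₀])
      (fun j => by rw [b3 _ (by omega) (by omega), a1 _ j.2, g14, g5]; rfl)
      (fun j => by
        rw [b1 _ j.2, a3 15 (by omega) (by omega), a3 5 (by omega) (by omega), g15, g5]; rfl)
    set ρ₄ := execs (inputMem x) (e.code 70) ρ₃
    have k4 : ∀ q, q ≠ 14 → q ≠ 15 → q < 50 → ρ₄ q = ρ₁ q := fun q h h' h'' => by
      rw [c1 q (by omega), k3 q h h' h'']
    obtain ⟨d1, d2⟩ := execs_initCode (inputMem x) ρ₄ (q := e.out 70)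
      (by rw [k4 2 (by omega) (by omega) (by omega), g2])
      (by rw [k4 3 (by omega) (by omega) (by omega), g3])
    refine ⟨fun q hq h h' => by rw [d2 q hq, k4 q h h' (by omega)], ?_⟩
    rw [d1, c2, k4 10 (by omega) (by omega) (by omega)]
    have ha : (i : ℕ) / C / Y < X ^ 8 := hY ▸
      Nat.div_lt_of_lt_mul (Nat.div_lt_of_lt_mul (by rw [mul_comm C, ← hp]; exact i.2))
    have hb : (i : ℕ) / C % Y < X ^ 8 := hY ▸ Nat.mod_lt _ hY0
    simp only [Expr.Arc, ← hX, ha, hb, true_and]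
  have setup : ∀ i : Fin p, _ := fun i =>
      execs_setupCode (inputMem x) (ρ₀ i) (by simp [hρ₀]) (i := i) (by simp [hρ₀])
        (X := X) (by simp [hρ₀, hX]) hY hC
  constructor <;> intro i <;> obtain ⟨_, rfl, k1, k2⟩ := key i _ rfl <;>
    obtain ⟨g0, g1, g2, g3, g4, g5, g9, g10, g14, g15, g16, g17, g20, g28, g36⟩ := setup i
  · rw [k1 _ (by omega) (by omega) (by omega), g0]
  · rw [k1 _ (by omega) (by omega) (by omega), g2]
  · rw [k1 _ (by omega) (by omega) (by omega), g3]
  · rw [k1 _ (by omega) (by omega) (by omega), g4]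
  · rw [k1 _ (by omega) (by omega) (by omega), g9]
  · rw [k1 _ (by omega) (by omega) (by omega), g20]
  · rw [k1 _ (by omega) (by omega) (by omega), g28]
  · rw [k1 _ (by omega) (by omega) (by omega), g36]
  · rw [k2, g10]
    simp only [ReachCircuit.gate, and_comm]
    congr 1
  · rw [k1 _ (by omega) (by omega) (by omega), g16]
  · rw [k1 _ (by omega) (by omega) (by omega), g17]

/-- A problem is in NC if its complement amounts to reachability of `1` from `0` in a graph whose
vertices are sequences of eight numbers less than `N + 2`, where `N` is the length of the input,
and whose arcs are described by an arithmetic expression. -/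
theorem inNC_of_reach {ι : Type} {enc : ι → List Bool} {Q : ι → Prop} (e : Expr)
    (hQ : ∀ z, Q z ↔ ¬ Relation.ReflTransGen (e.Arc (enc z)) 0 1) : InNC enc Q := by
  set Γ := fun r => (reachSizes e).getD r 1 with hΓdef
  have hΓ : ∀ I ∈ reachProgram e, Instr.Fits Γ I := fits_reachProgram e
  obtain ⟨w, hw1, hw⟩ : ∃ w, 1 ≤ w ∧ ∀ r, Γ r ≤ w := by
    refine ⟨(reachSizes e).foldr max 1, ?_, fun r => ?_⟩
    · induction reachSizes e with
      | nil => exact le_rfl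
      | cons a l ih => exact le_max_of_le_right ih
    · simp only [hΓdef]
      induction reachSizes e generalizing r with
      | nil => simp
      | cons a l ih =>
        cases r with
        | zero => simp
        | succ r => exact le_max_of_le_right (by simpa using ih r)
  set T₀ := (startCode e).length + (answerCode.length + 1) with hT₀
  refine ⟨reachProgram e, 25, w, T₀ + 324 * loopLength, 2, fun z => ?_⟩
  set x := enc z
  set N := x.length with hN
  set X := N + 2 with hX
  intro N' p T
  set Y := X ^ 8 with hY
  set C := X ^ 9 with hC
  set L := Nat.log 2 C with hL
  have hp : p = Y * Y * C := by
    show X ^ 25 = _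
    rw [hY, hC]; ring
  have hX2 : 2 ≤ X := by omega
  have hY2 : 2 ≤ Y := hX2.trans (Nat.le_self_pow (by omega) X)
  have hCY : 2 * Y ≤ C := by
    rw [hC, pow_succ, ← hY, mul_comm]; exact Nat.mul_le_mul_left _ hX2
  have hr : ∀ a b, e.Arc x a b → a < Y ∧ b < Y := fun a b h => ⟨h.1, h.2.1⟩
  -- the phases of the computation
  obtain ⟨ρ₁, s1, inv1⟩ := iterate_step_start (p := p) e x hX hY hC hp
  obtain ⟨ρ₂, mem₂, c₁, c₂, s2, inv2, hm2⟩ := iterate_step_loops hp (by omega) hCY e (inputMem x)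
    inv1 (by omega) (by omega) le_rfl (k := L * (L + 1) + L) rfl
  have s3 := iterate_step_lock_block (p := p) (startCode e ++ [.store 0 37] ++ updateCode ++
    [.jumpIfZero 68 (startCode e).length]) answerCode [.store 0 37]
    (by intro I hI; fin_cases hI <;> trivial) ρ₂ mem₂
  set ρ₃ := fun i => execs mem₂ answerCode (ρ₂ i)
  have hans : ∀ i, ρ₃ i 0 = i ∧
      ρ₃ i 37 = if mem₂ (C + 1) = 0 then 1 else 0 := by
    intro i
    simp [ρ₃, answerCode, execs_cons, execs_nil, Instr.exec, Op.eval, inv2.id, inv2.gates,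
      inv2.one, inv2.zero]
  have hlen : (startCode e ++ [Instr.store 0 37] ++ updateCode ++
      [Instr.jumpIfZero 68 (startCode e).length]).length = (startCode e).length + loopLength := by
    simp only [List.length_append, List.length_singleton, loopLength]
    omega
  have hP : startCode e ++ [Instr.store 0 37] ++ updateCode ++
      [Instr.jumpIfZero 68 (startCode e).length] ++ answerCode ++ [Instr.store 0 37] =
        reachProgram e := rfl
  have s4 := step_lock_store (P := reachProgram e) (p := p)
    (k := (startCode e).length + loopLength + answerCode.length) (r := 37)
    (by
      rw [← hP]
      exact getElem?_append_cons (by rw [List.length_append, hlen])) (fun i => (hans i).1) mem₂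
  rw [hlen, hP] at s3
  set t := (startCode e).length + (L * (L + 1) + L + 1) * loopLength + (answerCode.length + 1)
    with ht
  have hrun : run (reachProgram e) p x t = lock ((startCode e).length + loopLength +
      answerCode.length + 1) ρ₃ (fun a => if h : a < p then ρ₃ ⟨a, h⟩ 37 else mem₂ a) := by
    rw [run, show t = (answerCode.length + 1) + ((L * (L + 1) + L + 1) * loopLength +
        (startCode e).length) by omega, Function.iterate_add_apply _ (answerCode.length + 1),
      Function.iterate_add_apply _ (_ * loopLength), s1, s2, Function.iterate_succ_apply', s3, s4]
  have hhalt : ∀ i, ((run (reachProgram e) p x t).proc i).Halted (reachProgram e) := by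
    intro i
    rw [hrun]
    show (reachProgram e).length ≤ _
    rw [← hP, List.length_append, List.length_append, hlen]
    simp [lock]
  -- a halted machine does not change any more
  have hstay : ∀ s, run (reachProgram e) p x (s + t) = run (reachProgram e) p x t := by
    intro s
    induction s with
    | zero => rw [zero_add]
    | succ s ih =>
      have h := step_eq_self hhalt
      rw [← ih] at h
      rw [← ih, show s + 1 + t = s + t + 1 by omega]
      conv_lhs => rw [run, Function.iterate_succ_apply']
      exact h
  have htT : t ≤ T := by
    have hlog : 1 ≤ Nat.log 2 X := Nat.log_pos one_lt_two hX2
    -- `L + 1 ≤ 9 * (log X + 1) ≤ 18 * log X`, and `18 ^ 2 = 324`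
    have hL18 : L + 1 ≤ 18 * Nat.log 2 X := by
      have h1 : X ^ 9 < 2 ^ ((Nat.log 2 X + 1) * 9) := by
        rw [pow_mul]
        exact Nat.pow_lt_pow_left (Nat.lt_pow_succ_log_self one_lt_two X) (by omega)
      have h2 : L < (Nat.log 2 X + 1) * 9 := Nat.log_lt_of_lt_pow (by omega) h1
      omega
    have h1 : (L * (L + 1) + L + 1) ≤ 324 * Nat.log 2 X ^ 2 := by nlinarith
    have h2 : 1 ≤ Nat.log 2 X ^ 2 := Nat.one_le_pow _ _ hlog
    show _ ≤ (T₀ + 324 * loopLength) * Nat.log 2 X ^ 2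
    calc t = T₀ * 1 + (L * (L + 1) + L + 1) * loopLength := by omega
      _ ≤ T₀ * Nat.log 2 X ^ 2 + (324 * Nat.log 2 X ^ 2) * loopLength :=
        add_le_add (Nat.mul_le_mul_left _ h2) (Nat.mul_le_mul_right _ h1)
      _ = _ := by ring
  have hT : run (reachProgram e) p x T = run (reachProgram e) p x t := by
    rw [← hstay (T - t), Nat.sub_add_cancel htT]
  have hfits : ∀ t, (run (reachProgram e) p x t).Fits Γ X := run_fits (by omega) hX2 hΓ
    (le_refl (X ^ 25)) (le_refl 1)
  have hroot : cell Y C 0 1 1 = C + 1 := by simp [cell]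
  have hroot_lt : C + 1 < p := by
    rw [hp, ← hroot]
    exact cell_lt (by omega) (by omega) (by omega)
  refine ⟨⟨fun i => ?_, fun t => (hfits t).exclusiveWrite hΓ, fun t i r => ?_, fun t a => ?_⟩, ?_⟩
  · rw [hT]; exact hhalt i
  · exact lt_of_lt_of_le ((hfits t).reg_lt i r) (Nat.pow_le_pow_right (by omega) (hw r))
  · exact lt_of_lt_of_le ((hfits t).mem_lt a) (Nat.le_self_pow (by omega) X)
  · rw [hT, hrun, hQ, show enc z = x from rfl]
    have hp0 : 0 < p := by omega
    simp only [lock, hp0, dite_true, (hans _).2, hm2 _ hroot_lt]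
    rw [← hroot, gate_iff_reach hY2 hCY hr (t := 0 + (L * (L + 1) + L))
      (show L * (L + 1) ≤ _ by omega)]
    by_cases h : Relation.ReflTransGen (e.Arc x) 0 1 <;> simp [h]

end PRAM

/-! ### Directed cycles with a marked arc -/

/-- Going on along a permutation of a finite set, one returns. -/
theorem Equiv.Perm.reflTransGen_apply_self {V : Type*} [Finite V] (π : Equiv.Perm V)
    {r : V → V → Prop} {x : V} (h : ∀ m : ℕ, r ((π ^ m) x) ((π ^ (m + 1)) x)) :
    Relation.ReflTransGen r (π x) x := by
  have key : ∀ m : ℕ, Relation.ReflTransGen r (π x) ((π ^ (m + 1)) x) := by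
    intro m
    induction m with
    | zero => simp [Relation.ReflTransGen.refl]
    | succ m ih => exact ih.tail (h (m + 1))
  have := key (orderOf π - 1)
  rwa [Nat.sub_add_cancel (orderOf_pos π), pow_orderOf_eq_one, Equiv.Perm.one_apply] at this

/-- A digraph has a directed cycle through a marked arc if and only if the tail of a marked arc is
reachable from its head. -/
theorem exists_isDirectedCycle_iff {V : Type} {r s : V → V → Prop} (hsr : ∀ u v, s u v → r u v) :
    (∃ (k : ℕ) (c : Fin (k + 1) → V), IsDirectedCycle r c ∧ ∃ i, s (c i) (c (i + 1))) ↔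
      ∃ u v, s u v ∧ Relation.ReflTransGen r v u := by
  constructor
  · rintro ⟨k, c, ⟨-, hc⟩, i, hi⟩
    refine ⟨_, _, hi, ?_⟩
    have := (finRotate (k + 1)).reflTransGen_apply_self (r := fun i j => r (c i) (c j)) (x := i)
      fun m => by rw [pow_succ', Equiv.Perm.mul_apply, finRotate_apply]; exact hc _
    rw [finRotate_apply] at this
    exact Relation.ReflTransGen.lift c (fun _ _ h => h) _ _ this
  · rintro ⟨u, v, huv, hvu⟩
    obtain ⟨l, f, h0, hl, hf, hinj⟩ := hvu.exists_injOn_walk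
    have hlast : ∀ i : Fin (l + 1), ¬ (i : ℕ) < l → i = Fin.last l := fun i hi =>
      Fin.ext (by have := i.2; simp; omega)
    refine ⟨l, fun i => f i, ⟨fun i j hij => Fin.ext (hinj (Nat.lt_succ_iff.1 i.2)
      (Nat.lt_succ_iff.1 j.2) hij), fun i => ?_⟩, Fin.last l, ?_⟩
    · by_cases hi : (i : ℕ) < l
      · show r (f i) (f (i + 1 : Fin (l + 1)))
        rw [Fin.val_add_one_of_lt (Fin.lt_def.2 (by simpa using hi))]
        exact hf i hi
      · show r (f i) (f (i + 1 : Fin (l + 1)))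
        rw [hlast i hi, Fin.last_add_one, Fin.val_last, Fin.val_zero, hl, h0]
        exact hsr _ _ huv
    · show s (f (Fin.last l)) (f (Fin.last l + 1 : Fin (l + 1)))
      rwa [Fin.last_add_one, Fin.val_last, Fin.val_zero, hl, h0]

/-- The permutation that moves every vertex of a cycle to the next one. -/
theorem exists_perm_of_isDirectedCycle {V : Type} {r : V → V → Prop} {k : ℕ}
    {c : Fin (k + 1) → V} (hc : IsDirectedCycle r c) :
    ∃ π : Equiv.Perm V, (∀ i, π (c i) = c (i + 1)) ∧ ∀ x ∉ Set.range c, π x = x := by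
  refine ⟨Equiv.Perm.viaEmbedding (finRotate (k + 1)) ⟨c, hc.1⟩, fun i => ?_, fun x hx => ?_⟩
  · have := Equiv.Perm.viaEmbedding_apply (finRotate (k + 1)) ⟨c, hc.1⟩ i
    rwa [finRotate_apply] at this
  · exact Equiv.Perm.viaEmbedding_apply_of_notMem _ _ x hx

namespace HousingAllocation

variable {n m : ℕ} {I : HousingAllocation n m} {a : Fin n} {x y z : Option (Fin m)}

theorem prefers_asymm (hxy : I.Prefers a x y) : ¬ I.Prefers a y x := by
  cases x with
  | none => exact hxy.elim
  | some h =>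
    cases y with
    | none => exact id
    | some h' =>
      rintro ⟨i', j', hij', hi', hj'⟩
      obtain ⟨i, j, hij, hi, hj⟩ := hxy
      have h1 := (List.getElem?_inj (List.getElem?_eq_some_iff.1 hi).1 (I.pref_nodup a)).1
        (hi.trans hj'.symm)
      have h2 := (List.getElem?_inj (List.getElem?_eq_some_iff.1 hj).1 (I.pref_nodup a)).1
        (hj.trans hi'.symm)
      omega

theorem prefers_irrefl : ¬ I.Prefers a x x := fun h => prefers_asymm h h

theorem prefers_trichotomy (hx : ∀ h, x = some h → h ∈ I.pref a)
    (hy : ∀ h, y = some h → h ∈ I.pref a) : I.Prefers a x y ∨ x = y ∨ I.Prefers a y x := by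
  cases x with
  | none =>
    cases y with
    | none => exact Or.inr (Or.inl rfl)
    | some h' => exact Or.inr (Or.inr (hy h' rfl))
  | some h =>
    cases y with
    | none => exact Or.inl (hx h rfl)
    | some h' =>
      obtain ⟨i, hi, rfl⟩ := List.getElem_of_mem (hx h rfl)
      obtain ⟨j, hj, rfl⟩ := List.getElem_of_mem (hy h' rfl)
      rcases lt_trichotomy i j with hij | rfl | hij
      · exact Or.inl ⟨i, j, hij, List.getElem?_eq_getElem hi, List.getElem?_eq_getElem hj⟩
      · exact Or.inr (Or.inl rfl)
      · exact Or.inr (Or.inr ⟨j, i, hij, List.getElem?_eq_getElem hj,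
          List.getElem?_eq_getElem hi⟩)

theorem exists_eq_some_of_prefers (h : I.Prefers a x y) : ∃ h, x = some h ∧ h ∈ I.pref a := by
  cases x with
  | none => exact h.elim
  | some h' =>
    refine ⟨h', rfl, ?_⟩
    cases y with
    | none => exact h
    | some _ =>
      obtain ⟨i, -, -, hi, -⟩ := h
      exact List.mem_of_getElem? hi

end HousingAllocation

namespace HousingMarket

open HousingAllocation

variable {n : ℕ} {M : HousingMarket n} {μ : M.Matching}

theorem exists_endowment_eq_some (M : HousingMarket n) (a : Fin n) :
    ∃ h, M.endowment.house a = some h :=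
  Option.isSome_iff_exists.1 (M.endowment_perfect a)

theorem endowment_injective (M : HousingMarket n) : Function.Injective M.endowment.house := by
  intro a b hab
  obtain ⟨h, ha⟩ := M.exists_endowment_eq_some a
  exact M.endowment.injective a b h ha (hab ▸ ha)

/-- Every house belongs to someone. -/
theorem exists_endowment_eq (M : HousingMarket n) (h : Fin n) :
    ∃ a, M.endowment.house a = some h := by
  choose f hf using M.exists_endowment_eq_some
  have hinj : Function.Injective f := fun a b hab =>
    M.endowment_injective (by rw [hf, hf, hab])
  obtain ⟨a, rfl⟩ := Finite.surjective_of_injective hinj h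
  exact ⟨a, hf a⟩

theorem IndividuallyRational.exists_eq_some (h : M.IndividuallyRational μ) (a : Fin n) :
    ∃ h, μ.house a = some h := by
  obtain ⟨e, he⟩ := M.exists_endowment_eq_some a
  rcases h a with h | h
  · exact ⟨e, h.trans he⟩
  · obtain ⟨h', h1, -⟩ := exists_eq_some_of_prefers h
    exact ⟨h', h1⟩

/-- A matching in which every agent has a house is a permutation of any such matching. -/
theorem exists_perm_of_isSome (μ ν : M.Matching) (hμ : ∀ a, ∃ h, μ.house a = some h)
    (hν : ∀ a, ∃ h, ν.house a = some h) :
    ∃ π : Equiv.Perm (Fin n), ∀ a, ν.house a = μ.house (π a) := by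
  choose f hf using hμ
  choose g hg using hν
  have hf' : Function.Injective f := fun a b hab => μ.injective a b _ (hf a) (hab ▸ hf b)
  have hg' : Function.Injective g := fun a b hab => ν.injective a b _ (hg a) (hab ▸ hg b)
  refine ⟨(Equiv.ofBijective g (Finite.injective_iff_bijective.1 hg')).trans
    (Equiv.ofBijective f (Finite.injective_iff_bijective.1 hf')).symm, fun a => ?_⟩
  rw [hg, hf]
  congr 1
  exact ((Equiv.ofBijective f (Finite.injective_iff_bijective.1 hf')).apply_symm_apply
    (g a)).symm

/-! ### Pareto optimality -/

/-- Trading along a cycle of the envy digraph improves the matching. -/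
theorem exists_paretoDominates_of_isDirectedCycle {k : ℕ} {c : Fin (k + 1) → Fin n}
    (hc : IsDirectedCycle (M.EnvyArc μ) c) : ∃ ν : M.Matching, ν.ParetoDominates μ := by
  obtain ⟨π, hπ, hπ'⟩ := exists_perm_of_isDirectedCycle hc
  have harc : ∀ a, π a = a ∨ M.EnvyArc μ a (π a) := by
    intro a
    by_cases ha : a ∈ Set.range c
    · obtain ⟨i, rfl⟩ := ha
      rw [hπ]
      exact Or.inr (hc.2 i)
    · exact Or.inl (hπ' a ha)
  refine ⟨⟨fun a => μ.house (π a), fun a h hah => ?_, fun a b h ha hb =>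
    π.injective (μ.injective _ _ h ha hb)⟩, fun a => ?_, c 0, ?_⟩
  · rcases harc a with h1 | h1
    · rw [h1] at hah
      exact μ.acceptable a h hah
    · obtain ⟨h', h2, h3⟩ := exists_eq_some_of_prefers h1
      rw [hah] at h2
      exact (Option.some.inj h2) ▸ h3
  · rcases harc a with h1 | h1
    · left; show μ.house (π a) = _; rw [h1]
    · exact Or.inr h1
  · show M.Prefers (c 0) (μ.house (π (c 0))) _
    rw [hπ]
    exact hc.2 0

theorem IndividuallyRational.paretoOptimal_iff (hμ : M.IndividuallyRational μ) :
    μ.ParetoOptimal ↔ ¬ ∃ u v, M.EnvyArc μ u v ∧ Relation.ReflTransGen (M.EnvyArc μ) v u := by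
  refine not_congr ⟨?_, fun h => ?_⟩
  · rintro ⟨ν, hν, a, ha⟩
    have hν' : ∀ a, ∃ h, ν.house a = some h := by
      intro a
      rcases hν a with h | h
      · rw [h]; exact hμ.exists_eq_some a
      · obtain ⟨h', h1, -⟩ := exists_eq_some_of_prefers h
        exact ⟨h', h1⟩
    obtain ⟨π, hπ⟩ := exists_perm_of_isSome μ ν hμ.exists_eq_some hν'
    have hne : π a ≠ a := by
      intro h
      rw [hπ, h] at ha
      exact prefers_irrefl ha
    have harc : ∀ b, b ≠ π b → M.EnvyArc μ b (π b) := by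
      intro b hb
      rcases hν b with h | h
      · rw [hπ] at h
        obtain ⟨h', hh⟩ := hμ.exists_eq_some b
        exact absurd (μ.injective _ _ h' hh (h.trans hh)) hb
      · rwa [hπ] at h
    refine ⟨a, π a, harc a hne.symm, π.reflTransGen_apply_self fun m => ?_⟩
    rw [pow_succ', Equiv.Perm.mul_apply]
    refine harc _ fun h => hne ?_
    -- a point of the orbit of `a` is moved, as `a` is
    rw [← Equiv.Perm.mul_apply, ← pow_succ', pow_succ, Equiv.Perm.mul_apply] at h
    exact ((π ^ m).injective h).symm
  · obtain ⟨k, c, hc, -⟩ := (exists_isDirectedCycle_iff fun _ _ => id).2 h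
    exact exists_paretoDominates_of_isDirectedCycle hc

/-! ### The core -/

/-- The arcs of both kinds. -/
def CoreArc (M : HousingMarket n) (μ : M.Matching) (u v : Fin n) : Prop :=
  M.SolidArc μ u v ∨ M.DashedArc μ u v

theorem dashedArc_self_of_eq_none {u : Fin n} (hu : μ.house u = none) : M.DashedArc μ u u := by
  obtain ⟨h, hh⟩ := M.exists_endowment_eq_some u
  rw [DashedArc, hu, hh]
  exact M.endowment.acceptable u h hh

/-- The agents of a cycle with a dashed arc form a coalition. -/
theorem exists_isCoalition_of_isDirectedCycle {k : ℕ} {c : Fin (k + 1) → Fin n}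
    (hc : IsDirectedCycle (M.CoreArc μ) c) {i : Fin (k + 1)}
    (hi : M.DashedArc μ (c i) (c (i + 1))) : ∃ S, M.IsCoalition μ S := by
  classical
  obtain ⟨π, hπ, -⟩ := exists_perm_of_isDirectedCycle hc
  have hmem : ∀ i, c i ∈ Set.range c := fun i => ⟨i, rfl⟩
  refine ⟨Set.range c, ⟨fun a => if a ∈ Set.range c then M.endowment.house (π a) else none,
    fun a h hah => ?_, fun a b h ha hb => ?_⟩, ?_, ?_, c i, hmem i, ?_⟩
  · split_ifs at hah with ha
    obtain ⟨j, rfl⟩ := ha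
    rw [hπ] at hah
    rcases hc.2 j with h1 | h1
    · exact μ.acceptable _ _ (h1.trans hah)
    · obtain ⟨h', h2, h3⟩ := exists_eq_some_of_prefers h1
      rw [hah] at h2
      exact (Option.some.inj h2) ▸ h3
  · split_ifs at ha hb
    exact π.injective (M.endowment.injective _ _ h ha hb)
  · rintro _ ⟨j, rfl⟩
    exact ⟨c (j + 1), hmem _, by simp [hmem, hπ]⟩
  · rintro _ ⟨j, rfl⟩
    simp only [hmem, if_true, hπ]
    exact (hc.2 j).imp Eq.symm id
  · simp only [hmem, if_true, hπ]
    exact hi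

/-- A coalition contains a cycle with a dashed arc. -/
theorem exists_dashedArc_of_isCoalition {S : Set (Fin n)} (h : M.IsCoalition μ S) :
    ∃ u v, M.DashedArc μ u v ∧ Relation.ReflTransGen (M.CoreArc μ) v u := by
  obtain ⟨ν, h1, h2, a, ha, h3⟩ := h
  choose f hf hf' using h1
  let g : S → S := fun b => ⟨f b b.2, hf b b.2⟩
  have hg : ∀ b : S, ν.house b = M.endowment.house (g b) := fun b => hf' b b.2
  have hinj : Function.Injective g := by
    intro b c hbc
    obtain ⟨e, he⟩ := M.exists_endowment_eq_some (g b)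
    exact Subtype.ext (ν.injective b c e ((hg b).trans he) ((hg c).trans (hbc ▸ he)))
  let π : Equiv.Perm S := Equiv.ofBijective g (Finite.injective_iff_bijective.1 hinj)
  have harc : ∀ b : S, M.CoreArc μ b (π b) := by
    intro b
    rcases h2 b b.2 with h | h
    · exact Or.inl (h.symm.trans (hg b))
    · exact Or.inr (by rw [DashedArc]; exact (hg b) ▸ h)
  refine ⟨a, π ⟨a, ha⟩, by rw [DashedArc]; exact (hg ⟨a, ha⟩) ▸ h3, ?_⟩
  have := π.reflTransGen_apply_self (r := fun b c : S => M.CoreArc μ b c) (x := ⟨a, ha⟩)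
    fun m => by rw [pow_succ', Equiv.Perm.mul_apply]; exact harc _
  exact Relation.ReflTransGen.lift Subtype.val (fun _ _ h => h) _ _ this

theorem mem_core_iff : μ ∈ M.core ↔
    ¬ ∃ u v, M.DashedArc μ u v ∧ Relation.ReflTransGen (M.CoreArc μ) v u := by
  refine not_congr ⟨fun ⟨S, hS⟩ => exists_dashedArc_of_isCoalition hS, fun h => ?_⟩
  obtain ⟨k, c, hc, i, hi⟩ := (exists_isDirectedCycle_iff fun _ _ => Or.inr).2 h
  exact exists_isCoalition_of_isDirectedCycle hc hi

theorem exists_eq_some_of_mem_core (h : μ ∈ M.core) (a : Fin n) : ∃ h, μ.house a = some h := by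
  rcases hμ : μ.house a with _ | h'
  · exact absurd ⟨a, a, dashedArc_self_of_eq_none hμ, .refl⟩ (mem_core_iff.1 h)
  · exact ⟨h', rfl⟩

/-- The core has at most one element. The proof goes by induction along the dashed arcs of a
matching `μ` in the core, which lead from trading cycles of `μ` to trading cycles whose agents are known to
get the same houses in another matching `μ'` in the core. Hence on its trading cycle an agent does
not like its house in `μ'` better than the one in `μ`; if it liked it less, then this trading cycle
would be a coalition with respect to `μ'`. -/
theorem eq_of_mem_core {μ' : M.Matching} (hμ : μ ∈ M.core) (hμ' : μ' ∈ M.core) : μ' = μ := by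
  have hacyc := mem_core_iff.1 hμ
  have hsome := exists_eq_some_of_mem_core hμ
  obtain ⟨σ, hσ⟩ := exists_perm_of_isSome M.endowment μ M.exists_endowment_eq_some hsome
  have hback : ∀ x, Relation.ReflTransGen (M.SolidArc μ) (σ x) x := fun x =>
    σ.reflTransGen_apply_self fun m => by
      rw [pow_succ', Equiv.Perm.mul_apply]; exact hσ _
  have hback' : ∀ x, Relation.ReflTransGen (M.CoreArc μ) (σ x) x := fun x =>
    Relation.ReflTransGen.mono (fun _ _ => Or.inl) _ _ (hback x)
  -- `below v u`: some walk from `u` to `v` contains a dashed arc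
  let below : Fin n → Fin n → Prop := fun v u => ∃ x y,
    Relation.ReflTransGen (M.CoreArc μ) u x ∧ M.DashedArc μ x y ∧
      Relation.ReflTransGen (M.CoreArc μ) y v
  have hirr : Std.Irrefl below := ⟨fun u ⟨x, y, h1, h2, h3⟩ => hacyc ⟨x, y, h2, h3.trans h1⟩⟩
  have htrans : IsTrans (Fin n) below := ⟨fun u v w ⟨x, y, h1, h2, h3⟩ ⟨x', y', h1', h2', h3'⟩ =>
    ⟨x', y', h1', h2', (h3'.trans h1).tail (Or.inr h2) |>.trans h3⟩⟩
  have hwf : WellFounded below := Finite.wellFounded_of_trans_of_irrefl below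
  have main : ∀ u, μ'.house u = μ.house u := by
    intro u
    induction u using hwf.induction with
    | _ u ih =>
      have hno : ∀ x, Relation.ReflTransGen (M.SolidArc μ) u x →
          ¬ M.Prefers x (μ'.house x) (μ.house x) := by
        intro x hux hx
        have hux' : Relation.ReflTransGen (M.CoreArc μ) u x := 
          Relation.ReflTransGen.mono (fun _ _ => Or.inl) _ _ hux
        obtain ⟨h, hh⟩ := exists_eq_some_of_mem_core hμ' x
        obtain ⟨w, hw⟩ := M.exists_endowment_eq h
        have hdash : M.DashedArc μ x w := by rw [DashedArc, hw, ← hh]; exact hx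
        obtain ⟨z, rfl⟩ := σ.surjective w
        have hz := ih z ⟨x, σ z, hux', hdash, hback' z⟩
        have hzx : z = x := μ'.injective z x h (by rw [hz, hσ, hw]) hh
        subst hzx
        exact hacyc ⟨z, σ z, hdash, hback' z⟩
      by_contra hne
      refine hμ' ⟨{x | Relation.ReflTransGen (M.SolidArc μ) u x}, μ, fun a ha =>
        ⟨σ a, ha.tail (hσ a), hσ a⟩, fun a ha => ?_, u, .refl, ?_⟩
      · rcases prefers_trichotomy (μ'.acceptable a) (μ.acceptable a) with h | h | h
        · exact absurd h (hno a ha)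
        · exact Or.inl h.symm
        · exact Or.inr h
      · rcases prefers_trichotomy (μ'.acceptable u) (μ.acceptable u) with h | h | h
        · exact absurd h (hno u .refl)
        · exact absurd h hne
        · exact h
  exact Matching.ext (funext main)

theorem core_eq_singleton_iff : M.core = {μ} ↔
    ¬ ∃ u v, M.DashedArc μ u v ∧ Relation.ReflTransGen (M.CoreArc μ) v u := by
  rw [← mem_core_iff]
  constructor
  · intro h
    rw [h]
    rfl
  · intro h
    exact Set.eq_singleton_iff_unique_mem.2 ⟨h, fun μ' hμ' => eq_of_mem_core h hμ'⟩

end HousingMarket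

/-! ### The configuration graph -/

namespace PRAM

namespace Expr

/-- Conjunction, where `0` means "false" and any other number means "true". -/
def and (e f : Expr) : Expr := .op .mul e f

def or (e f : Expr) : Expr := .op .add e f

def not (e : Expr) : Expr := .op .eq e (.const 0)

def eq (e f : Expr) : Expr := .op .eq e f

def lt (e f : Expr) : Expr := .op .lt e f

variable {mem : ℕ → ℕ} {N : ℕ} {x y : Fin 8 → ℕ} {e f : Expr}

theorem eval_and : (e.and f).eval mem N x y ≠ 0 ↔ e.eval mem N x y ≠ 0 ∧ f.eval mem N x y ≠ 0 :=
  Nat.mul_ne_zero_iff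

theorem eval_or : (e.or f).eval mem N x y ≠ 0 ↔ e.eval mem N x y ≠ 0 ∨ f.eval mem N x y ≠ 0 := by
  show e.eval mem N x y + f.eval mem N x y ≠ 0 ↔ _
  omega

theorem eval_not : e.not.eval mem N x y ≠ 0 ↔ e.eval mem N x y = 0 := by
  show (if e.eval mem N x y = 0 then 1 else 0) ≠ 0 ↔ _
  split_ifs with h <;> simp [h]

theorem eval_eq : (e.eq f).eval mem N x y ≠ 0 ↔ e.eval mem N x y = f.eval mem N x y := by
  simp [eq, eval, Op.eval]

theorem eval_lt : (e.lt f).eval mem N x y ≠ 0 ↔ e.eval mem N x y < f.eval mem N x y := by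
  simp [lt, eval, Op.eval]

end Expr

/-- Address of the entry `(w, h)` of the matrix of the initial endowment (`c = 0`) or of the
matching (`c = 1`) in the encoding of a market with `ν` agents. -/
def tableAddr (c ν w h : ℕ) : ℕ := ν * ν * ν + c * (ν * ν) + (w * ν + h)

/-- Address of the bit that tells whether `h` is at position `k` of the preference list of `w`. -/
def prefAddr (ν w k h : ℕ) : ℕ := (w * ν + k) * ν + h

/-- The bit at the address `tableAddr c ν w h`. -/
def tableExpr (c : ℕ) (ν w h : Expr) : Expr :=
  .load (.op .add (.op .add (.op .mul (.op .mul ν ν) ν) (.op .mul (.const c) (.op .mul ν ν)))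
    (.op .add (.op .mul w ν) h))

/-- The bit at the address `prefAddr ν w k h`. -/
def prefExpr (ν w k h : Expr) : Expr :=
  .load (.op .add (.op .mul (.op .add (.op .mul w ν) k) ν) h)

/-- `ν` is the number of agents, if `N` is the length of the input. -/
def IsSize (N ν : ℕ) : Prop := ν * ν * ν + ν * ν + ν * ν = N

/-- The expression for `IsSize`. -/
def sizeExpr (ν : Expr) : Expr :=
  .eq (.op .add (.op .add (.op .mul (.op .mul ν ν) ν) (.op .mul ν ν)) (.op .mul ν ν)) .len

/-- The digits `4` to `7` of `x` are houses and positions `h`, `k`, `g`, `l` such that the agent in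
digit `3` gets `g` in the matching, and has `g` at position `l` and `h` at position `k` of its
list. -/
def IsGuess (mem : ℕ → ℕ) (x : Fin 8 → ℕ) : Prop :=
  x 4 < x 1 ∧ x 5 < x 1 ∧ x 6 < x 1 ∧ x 7 < x 1 ∧ mem (tableAddr 1 (x 1) (x 3) (x 6)) ≠ 0 ∧
    mem (prefAddr (x 1) (x 3) (x 7) (x 6)) ≠ 0 ∧ mem (prefAddr (x 1) (x 3) (x 5) (x 4)) ≠ 0

/-- The expression for `IsGuess`, applied to the tail of the arc. -/
def guessExpr : Expr :=
  ((Expr.src 4).lt (.src 1)).and <| ((Expr.src 5).lt (.src 1)).and <|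
    ((Expr.src 6).lt (.src 1)).and <| ((Expr.src 7).lt (.src 1)).and <|
    (tableExpr 1 (.src 1) (.src 3) (.src 6)).and <|
    (prefExpr (.src 1) (.src 3) (.src 7) (.src 6)).and
    (prefExpr (.src 1) (.src 3) (.src 5) (.src 4))

/-- Arcs of the configuration graph of a nondeterministic search for a reason to reject. A
configuration consists of eight numbers: the mode, the number of agents, the agent `u` at which a
closed walk started, the present agent `w`, and the numbers `h`, `k`, `g`, `l` of `IsGuess`. The
modes are
* `0`: start;
* `1`: reject;
* `2`: looking for the house of `w`; all houses less than `h` have been excluded;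
* `3`: at the start of a closed walk;
* `4`: on a closed walk of which the first arc is strict.

The walk goes from `w` to the agents that have `h`, in the initial endowment for `c = 0` and in the
matching for `c = 1`, where `h` is at least as good for `w` as its house `g` in the matching; the
arc is strict if `h` is better. In mode `3` the search also rejects if `w` prefers its initial house. -/
def ConfigArc (c : ℕ) (mem : ℕ → ℕ) (N : ℕ) (x y : Fin 8 → ℕ) : Prop :=
  (x 0 = 0 ∧ IsSize N (y 1) ∧ y 0 = 2 ∧ y 3 < y 1 ∧ y 4 = 0) ∨
  (x 0 = 2 ∧ y 0 = 2 ∧ y 1 = x 1 ∧ y 3 = x 3 ∧ y 4 = x 4 + 1 ∧ x 4 < x 1 ∧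
    mem (tableAddr 1 (x 1) (x 3) (x 4)) = 0) ∨
  (x 0 = 2 ∧ x 4 = x 1 ∧ y 0 = 1) ∨
  (x 0 = 0 ∧ IsSize N (y 1) ∧ y 0 = 3 ∧ y 3 < y 1 ∧ y 2 = y 3) ∨
  (x 0 = 3 ∧ IsGuess mem x ∧ x 5 < x 7 ∧ mem (tableAddr 0 (x 1) (x 3) (x 4)) ≠ 0 ∧ y 0 = 1) ∨
  (((x 0 = 3 ∧ x 5 < x 7) ∨ (x 0 = 4 ∧ x 5 < x 7 + 1)) ∧ IsGuess mem x ∧ y 0 = 4 ∧ y 1 = x 1 ∧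
    y 2 = x 2 ∧ y 3 < x 1 ∧ mem (tableAddr c (x 1) (y 3) (x 4)) ≠ 0) ∨
  (x 0 = 4 ∧ x 2 = x 3 ∧ y 0 = 1)

/-- The expression for `ConfigArc`. -/
def configExpr (c : ℕ) : Expr :=
  (((Expr.src 0).eq (.const 0)).and <| (sizeExpr (.tgt 1)).and <|
    ((Expr.tgt 0).eq (.const 2)).and <| ((Expr.tgt 3).lt (.tgt 1)).and <|
    (Expr.tgt 4).eq (.const 0)).or <|
  (((Expr.src 0).eq (.const 2)).and <| ((Expr.tgt 0).eq (.const 2)).and <|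
    ((Expr.tgt 1).eq (.src 1)).and <| ((Expr.tgt 3).eq (.src 3)).and <|
    ((Expr.tgt 4).eq (.op .add (.src 4) (.const 1))).and <| ((Expr.src 4).lt (.src 1)).and <|
    (tableExpr 1 (.src 1) (.src 3) (.src 4)).not).or <|
  (((Expr.src 0).eq (.const 2)).and <| ((Expr.src 4).eq (.src 1)).and <|
    (Expr.tgt 0).eq (.const 1)).or <|
  (((Expr.src 0).eq (.const 0)).and <| (sizeExpr (.tgt 1)).and <|
    ((Expr.tgt 0).eq (.const 3)).and <| ((Expr.tgt 3).lt (.tgt 1)).and <|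
    (Expr.tgt 2).eq (.tgt 3)).or <|
  (((Expr.src 0).eq (.const 3)).and <| guessExpr.and <| ((Expr.src 5).lt (.src 7)).and <|
    (tableExpr 0 (.src 1) (.src 3) (.src 4)).and <| (Expr.tgt 0).eq (.const 1)).or <|
  (((((Expr.src 0).eq (.const 3)).and ((Expr.src 5).lt (.src 7))).or
      (((Expr.src 0).eq (.const 4)).and
        ((Expr.src 5).lt (.op .add (.src 7) (.const 1))))).and <|
    guessExpr.and <| ((Expr.tgt 0).eq (.const 4)).and <| ((Expr.tgt 1).eq (.src 1)).and <|
    ((Expr.tgt 2).eq (.src 2)).and <| ((Expr.tgt 3).lt (.src 1)).and <|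
    tableExpr c (.src 1) (.tgt 3) (.src 4)).or <|
  ((Expr.src 0).eq (.const 4)).and <| ((Expr.src 2).eq (.src 3)).and <|
    (Expr.tgt 0).eq (.const 1)

theorem eval_configExpr {c : ℕ} {mem : ℕ → ℕ} {N : ℕ} {x y : Fin 8 → ℕ} :
    (configExpr c).eval mem N x y ≠ 0 ↔ ConfigArc c mem N x y := by
  simp only [configExpr, guessExpr, Expr.eval_or, Expr.eval_and, Expr.eval_eq, Expr.eval_lt,
    Expr.eval_not, sizeExpr]
  rfl

section Arcs

variable {c n u v w h k g l h' k' g' l' N : ℕ} {mem : ℕ → ℕ} {x y : Fin 8 → ℕ}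

theorem ConfigArc.start_scan (hx : x 0 = 0) (hs : IsSize N n) (hw : w < n) :
    ConfigArc c mem N x ![2, n, u, w, 0, k, g, l] := by
  simp [ConfigArc, hx, hs, hw]

theorem ConfigArc.scan (hh : h < n) (hm : mem (tableAddr 1 n w h) = 0) :
    ConfigArc c mem N ![2, n, u, w, h, k, g, l] ![2, n, u, w, h + 1, k, g, l] := by
  simp [ConfigArc, hh, hm]

theorem ConfigArc.scan_reject (hy : y 0 = 1) :
    ConfigArc c mem N ![2, n, u, w, n, k, g, l] y := by
  simp [ConfigArc, hy]

theorem ConfigArc.start_walk (hx : x 0 = 0) (hs : IsSize N n) (hw : w < n) :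
    ConfigArc c mem N x ![3, n, w, w, h, k, g, l] := by
  simp [ConfigArc, hx, hs, hw]

theorem ConfigArc.first_reject (hg : IsGuess mem ![3, n, w, w, h, k, g, l]) (hkl : k < l)
    (hm : mem (tableAddr 0 n w h) ≠ 0) (hy : y 0 = 1) :
    ConfigArc c mem N ![3, n, w, w, h, k, g, l] y := by
  simp [ConfigArc, hg, hkl, hm, hy]

theorem ConfigArc.first (hg : IsGuess mem ![3, n, u, w, h, k, g, l]) (hkl : k < l) (hv : v < n)
    (hm : mem (tableAddr c n v h) ≠ 0) :
    ConfigArc c mem N ![3, n, u, w, h, k, g, l] ![4, n, u, v, h', k', g', l'] := by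
  simp [ConfigArc, hg, hkl, hv, hm]

theorem ConfigArc.walk (hg : IsGuess mem ![4, n, u, w, h, k, g, l]) (hkl : k ≤ l) (hv : v < n)
    (hm : mem (tableAddr c n v h) ≠ 0) :
    ConfigArc c mem N ![4, n, u, w, h, k, g, l] ![4, n, u, v, h', k', g', l'] := by
  simp [ConfigArc, hg, hkl, hv, hm]

theorem ConfigArc.walk_reject (hy : y 0 = 1) :
    ConfigArc c mem N ![4, n, w, w, h, k, g, l] y := by
  simp [ConfigArc, hy]

end Arcs

/-- Every sequence of eight digits is that of a vertex. -/
theorem exists_digit_eq {X : ℕ} {f : Fin 8 → ℕ} (hf : ∀ i, f i < X) :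
    ∃ v < X ^ 8, digit X v = f := by
  refine ⟨finFunctionFinEquiv fun i => ⟨f i, hf i⟩, (finFunctionFinEquiv _).2, funext fun i => ?_⟩
  have := congrFun (finFunctionFinEquiv.symm_apply_apply fun i => (⟨f i, hf i⟩ : Fin X)) i
  exact congrArg Fin.val this

end PRAM

/-! ### The input bits -/

namespace MarketWithMatching

open PRAM

variable (z : MarketWithMatching)

theorem length_encode :
    z.encode.length = z.n * z.n * z.n + z.n * z.n + z.n * z.n := by
  simp [encode, HousingAllocation.bits, HousingAllocation.Matching.bits, add_assoc]

/-- The initial endowment (`0`) and the matching (`1`). -/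
def table : ℕ → z.market.Matching
  | 0 => z.market.endowment
  | _ => z.matching

theorem isSize_length_iff {ν : ℕ} : IsSize z.encode.length ν ↔ ν = z.n := by
  rw [IsSize, length_encode]
  refine ⟨fun h => ?_, fun h => by rw [h]⟩
  have key : ∀ {a b : ℕ}, a < b → a * a * a + a * a + a * a < b * b * b + b * b + b * b := by
    intro a b hab
    have h1 : a * a < b * b := Nat.mul_self_lt_mul_self hab
    have h2 : a * a * a ≤ b * b * b := Nat.mul_le_mul h1.le hab.le
    omega
  rcases lt_trichotomy ν z.n with h' | h' | h'
  · exact absurd h (key h').ne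
  · exact h'
  · exact absurd h (key h').ne'

theorem inputMem_ne_zero {x : List Bool} {a : ℕ} : inputMem x a ≠ 0 ↔ x[a]? = some true := by
  simp [inputMem]

theorem lt_mul_of_lt {n w h : ℕ} (hw : w < n) (hh : h < n) : w * n + h < n * n := by
  have : (w + 1) * n ≤ n * n := Nat.mul_le_mul_right n hw
  rw [add_mul] at this
  omega

theorem getElem?_matching_bits {n : ℕ} {I : HousingAllocation n n} (μ : I.Matching)
    (w h : Fin n) : μ.bits[(w : ℕ) * n + h]? = some true ↔ μ.house w = some h := by
  have hlt := lt_mul_of_lt w.2 h.2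
  have hn : 0 < n := w.pos
  have h1 : Fin.divNat ⟨(w : ℕ) * n + h, hlt⟩ = w := Fin.ext (by
    simp [Fin.divNat, mul_comm (w : ℕ), Nat.mul_add_div hn])
  have h2 : Fin.modNat ⟨(w : ℕ) * n + h, hlt⟩ = h := Fin.ext (by
    simp [Fin.modNat, mul_comm (w : ℕ), Nat.mod_eq_of_lt h.2])
  rw [HousingAllocation.Matching.bits, List.getElem?_ofFn, dif_pos hlt, h1, h2]
  simp

theorem inputMem_tableAddr {c : ℕ} (hc : c ≤ 1) (w h : Fin z.n) :
    inputMem z.encode (tableAddr c z.n w h) ≠ 0 ↔ (z.table c).house w = some h := by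
  have hlt := lt_mul_of_lt w.2 h.2
  rw [inputMem_ne_zero, encode, tableAddr]
  have hl1 : z.market.toHousingAllocation.bits.length = z.n * z.n * z.n := by
    simp [HousingAllocation.bits]
  have hl2 : z.market.endowment.bits.length = z.n * z.n := by
    simp [HousingAllocation.Matching.bits]
  rcases Nat.le_one_iff_eq_zero_or_eq_one.1 hc with rfl | rfl
  · rw [List.append_assoc, List.getElem?_append_right (by omega), hl1,
      show z.n * z.n * z.n + 0 * (z.n * z.n) + (w * z.n + h) - z.n * z.n * z.n =
        w * z.n + h by omega,
      List.getElem?_append_left (by omega), getElem?_matching_bits]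
    rfl
  · rw [List.getElem?_append_right (by rw [List.length_append]; omega), List.length_append, hl1,
      hl2,
      show z.n * z.n * z.n + 1 * (z.n * z.n) + (w * z.n + h) - (z.n * z.n * z.n + z.n * z.n) =
        w * z.n + h by omega, getElem?_matching_bits]
    rfl

theorem inputMem_prefAddr (w k h : Fin z.n) :
    inputMem z.encode (prefAddr z.n w k h) ≠ 0 ↔ (z.market.pref w)[(k : ℕ)]? = some h := by
  have hn : 0 < z.n := w.pos
  have hlt := lt_mul_of_lt w.2 k.2
  have hlt' : ((w : ℕ) * z.n + k) * z.n + h < z.n * z.n * z.n := by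
    have : ((w : ℕ) * z.n + k + 1) * z.n ≤ z.n * z.n * z.n := Nat.mul_le_mul_right _ hlt
    have := h.2
    rw [add_mul (_ + _)] at *
    omega
  have h1 : Fin.divNat ⟨((w : ℕ) * z.n + k) * z.n + h, hlt'⟩ = ⟨(w : ℕ) * z.n + k, hlt⟩ :=
    Fin.ext (by simp [Fin.divNat, mul_comm _ z.n, Nat.mul_add_div hn])
  have h2 : Fin.modNat ⟨((w : ℕ) * z.n + k) * z.n + h, hlt'⟩ = h :=
    Fin.ext (by simp [Fin.modNat, mul_comm _ z.n, Nat.mod_eq_of_lt h.2])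
  have h3 : Fin.divNat ⟨(w : ℕ) * z.n + k, hlt⟩ = w :=
    Fin.ext (by simp [Fin.divNat, mul_comm _ z.n, Nat.mul_add_div hn])
  have h4 : Fin.modNat ⟨(w : ℕ) * z.n + k, hlt⟩ = k :=
    Fin.ext (by simp [Fin.modNat, mul_comm _ z.n, Nat.mod_eq_of_lt k.2])
  have hl1 : z.market.toHousingAllocation.bits.length = z.n * z.n * z.n := by
    simp [HousingAllocation.bits]
  rw [inputMem_ne_zero, encode, prefAddr, List.append_assoc,
    List.getElem?_append_left (by omega), HousingAllocation.bits, List.getElem?_ofFn,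
    dif_pos hlt', h1, h2, h3, h4]
  simp

end MarketWithMatching

/-! ### Correctness of the configuration graph -/

namespace MarketWithMatching

open PRAM

variable (z : MarketWithMatching)

/-- The agent `u` has a house `g` at position `l` of its list in the matching, and `v` has a house
at position `k` of the list of `u`, in the initial endowment for `c = 0` and in the matching for
`c = 1`, where `R k l`. -/
def TradeArc (c : ℕ) (R : ℕ → ℕ → Prop) (u v : Fin z.n) : Prop :=
  ∃ h g k l : Fin z.n, R k l ∧ z.matching.house u = some g ∧
    (z.market.pref u)[(l : ℕ)]? = some g ∧ (z.market.pref u)[(k : ℕ)]? = some h ∧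
    (z.table c).house v = some h

/-- The reasons to reject for which the configuration graph searches. -/
def Rejected (c : ℕ) : Prop :=
  (∃ a, z.matching.house a = none) ∨ (∃ a, z.TradeArc 0 (· < ·) a a) ∨
    ∃ u v, z.TradeArc c (· < ·) u v ∧ Relation.ReflTransGen (z.TradeArc c (· ≤ ·)) v u

variable {z} {c : ℕ}

theorem IsGuess.exists_fin {x : Fin 8 → ℕ} (h1 : x 1 = z.n) (h3 : x 3 < z.n)
    (hx : IsGuess (inputMem z.encode) x) :
    ∃ (h k g l : Fin z.n), x 4 = h ∧ x 5 = k ∧ x 6 = g ∧ x 7 = l ∧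
      z.matching.house ⟨x 3, h3⟩ = some g ∧ (z.market.pref ⟨x 3, h3⟩)[(l : ℕ)]? = some g ∧
      (z.market.pref ⟨x 3, h3⟩)[(k : ℕ)]? = some h := by
  obtain ⟨h4, h5, h6, h7, hm, hp, hp'⟩ := hx
  rw [h1] at *
  exact ⟨⟨_, h4⟩, ⟨_, h5⟩, ⟨_, h6⟩, ⟨_, h7⟩, rfl, rfl, rfl, rfl,
    (z.inputMem_tableAddr le_rfl ⟨_, h3⟩ ⟨_, h6⟩).1 hm,
    (z.inputMem_prefAddr ⟨_, h3⟩ ⟨_, h7⟩ ⟨_, h6⟩).1 hp,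
    (z.inputMem_prefAddr ⟨_, h3⟩ ⟨_, h5⟩ ⟨_, h4⟩).1 hp'⟩

theorem isGuess_vec {σ u : ℕ} {w h k g l : Fin z.n} (hm : z.matching.house w = some g)
    (hl : (z.market.pref w)[(l : ℕ)]? = some g) (hk : (z.market.pref w)[(k : ℕ)]? = some h) :
    IsGuess (inputMem z.encode) ![σ, z.n, u, w, h, k, g, l] := by
  have h1 := (z.inputMem_tableAddr (le_refl 1) w g).2 hm
  have h2 := (z.inputMem_prefAddr w l g).2 hl
  have h3 := (z.inputMem_prefAddr w k h).2 hk
  simp [IsGuess, h1, h2, h3]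

/-- What holds in each mode of the configurations that are reachable from the start. -/
structure ConfigInv (z : MarketWithMatching) (c : ℕ) (x : Fin 8 → ℕ) : Prop where
  reject : x 0 = 1 → z.Rejected c
  scan : x 0 = 2 → x 1 = z.n ∧ ∃ w : Fin z.n, x 3 = w ∧
    ∀ h : Fin z.n, (h : ℕ) < x 4 → z.matching.house w ≠ some h
  first : x 0 = 3 → x 1 = z.n ∧ ∃ w : Fin z.n, x 2 = w ∧ x 3 = w
  walk : x 0 = 4 → x 1 = z.n ∧ ∃ u v w : Fin z.n, x 2 = u ∧ x 3 = w ∧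
    z.TradeArc c (· < ·) u v ∧ Relation.ReflTransGen (z.TradeArc c (· ≤ ·)) v w

theorem ConfigInv.step (hc : c ≤ 1) {x y : Fin 8 → ℕ} (hx : ConfigInv z c x)
    (h : ConfigArc c (inputMem z.encode) z.encode.length x y) : ConfigInv z c y := by
  have mk1 : y 0 = 1 → z.Rejected c → ConfigInv z c y := fun h h' =>
    ⟨fun _ => h', fun h2 => by omega, fun h2 => by omega, fun h2 => by omega⟩
  have mk4 : y 0 = 4 → (y 1 = z.n ∧ ∃ u v w : Fin z.n, y 2 = u ∧ y 3 = w ∧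
      z.TradeArc c (· < ·) u v ∧ Relation.ReflTransGen (z.TradeArc c (· ≤ ·)) v w) →
      ConfigInv z c y := fun h h' =>
    ⟨fun h2 => by omega, fun h2 => by omega, fun h2 => by omega, fun _ => h'⟩
  rcases h with ⟨h0, hs, h0', h3, h4⟩ | ⟨h0, h0', h1, h3, h4, h4', hm⟩ | ⟨h0, h4, h0'⟩ |
    ⟨h0, hs, h0', h3, h2⟩ | ⟨h0, hg, h5, hm, h0'⟩ | ⟨h0, hg, h0', h1, h2, h3, hm⟩ | ⟨h0, h2, h0'⟩
  · rw [isSize_length_iff] at hs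
    refine ⟨fun _ => by omega, fun _ => ⟨hs, ⟨y 3, hs ▸ h3⟩, rfl, fun h hh => by omega⟩,
      fun _ => by omega, fun _ => by omega⟩
  · obtain ⟨g1, w, g3, g4⟩ := hx.scan h0
    refine ⟨fun _ => by omega, fun _ => ⟨h1.trans g1, w, h3.trans g3, fun h hh => ?_⟩,
      fun _ => by omega, fun _ => by omega⟩
    rcases (by omega : (h : ℕ) < x 4 ∨ (h : ℕ) = x 4) with hlt | heq
    · exact g4 h hlt
    · rw [g1, g3, ← heq] at hm
      exact fun hh => (z.inputMem_tableAddr le_rfl w h).2 hh hm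
  · obtain ⟨g1, w, g3, g4⟩ := hx.scan h0
    refine mk1 h0' (Or.inl ⟨w, ?_⟩)
    rcases hw : z.matching.house w with _ | h
    · rfl
    · exact absurd hw (g4 h (by have := h.2; omega))
  · rw [isSize_length_iff] at hs
    exact ⟨fun _ => by omega, fun _ => by omega, fun _ => ⟨hs, ⟨y 3, hs ▸ h3⟩, h2, rfl⟩,
      fun _ => by omega⟩
  · obtain ⟨g1, w, g2, g3⟩ := hx.first h0
    have h3 : x 3 < z.n := g3 ▸ w.2
    obtain ⟨h, k, g, l, e4, e5, e6, e7, f1, f2, f3⟩ := IsGuess.exists_fin g1 h3 hg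
    have hw : (⟨x 3, h3⟩ : Fin z.n) = w := Fin.ext g3
    rw [hw] at f1 f2 f3
    rw [g1, g3, e4] at hm
    exact mk1 h0' (Or.inr (Or.inl ⟨w, h, g, k, l, by rwa [← e5, ← e7], f1, f2, f3,
      (z.inputMem_tableAddr (by omega) w h).1 hm⟩))
  · rcases h0 with ⟨h0, h5⟩ | ⟨h0, h5⟩
    · obtain ⟨g1, w, g2, g3⟩ := hx.first h0
      have h3' : x 3 < z.n := g3 ▸ w.2
      obtain ⟨h, k, g, l, e4, e5, e6, e7, f1, f2, f3⟩ := IsGuess.exists_fin g1 h3' hg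
      have hw : (⟨x 3, h3'⟩ : Fin z.n) = w := Fin.ext g3
      rw [hw] at f1 f2 f3
      rw [g1] at h3
      rw [g1, e4] at hm
      exact mk4 h0' ⟨h1.trans g1, w, ⟨y 3, h3⟩, ⟨y 3, h3⟩, h2.trans g2, rfl,
        ⟨h, g, k, l, by rwa [← e5, ← e7], f1, f2, f3,
          (z.inputMem_tableAddr hc ⟨y 3, h3⟩ h).1 hm⟩, .refl⟩
    · obtain ⟨g1, u, v, w, g2, g3, g4, g5⟩ := hx.walk h0
      have h3' : x 3 < z.n := g3 ▸ w.2
      obtain ⟨h, k, g, l, e4, e5, e6, e7, f1, f2, f3⟩ := IsGuess.exists_fin g1 h3' hg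
      have hw : (⟨x 3, h3'⟩ : Fin z.n) = w := Fin.ext g3
      rw [hw] at f1 f2 f3
      rw [g1] at h3
      rw [g1, e4] at hm
      exact mk4 h0' ⟨h1.trans g1, u, v, ⟨y 3, h3⟩, h2.trans g2, rfl, g4,
        g5.tail ⟨h, g, k, l, by rw [← e5, ← e7]; omega, f1, f2, f3,
          (z.inputMem_tableAddr hc ⟨y 3, h3⟩ h).1 hm⟩⟩
  · obtain ⟨g1, u, v, w, g2, g3, g4, g5⟩ := hx.walk h0
    have huw : w = u := Fin.ext (by omega)
    subst huw
    exact mk1 h0' (Or.inr (Or.inr ⟨w, v, g4, g5⟩))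

/-- The search rejects if and only if there is a reason to do so. -/
theorem reflTransGen_arc_iff (hc : c ≤ 1) :
    Relation.ReflTransGen ((configExpr c).Arc z.encode) 0 1 ↔ z.Rejected c := by
  obtain ⟨N, hN⟩ : ∃ N, N = z.encode.length := ⟨_, rfl⟩
  obtain ⟨X, hX⟩ : ∃ X, X = z.encode.length + 2 := ⟨_, rfl⟩
  have hX0 : 0 < X := by omega
  have hd0 : digit X 0 0 = 0 := by simp [digit]
  have hd1 : digit X 1 0 = 1 := by simp [digit, Nat.mod_eq_of_lt (show 1 < X by omega)]
  have h0lt : 0 < X ^ 8 := Nat.pow_pos hX0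
  have h1lt : 1 < X ^ 8 := Nat.one_lt_pow (by omega) (by omega)
  constructor
  · intro h
    have key : ∀ v, Relation.ReflTransGen ((configExpr c).Arc z.encode) 0 v →
        ConfigInv z c (digit X v) := by
      intro v hv
      induction hv with
      | refl => constructor <;> intro h <;> rw [hd0] at h <;> omega
      | tail _ hab ih => exact ih.step hc (eval_configExpr.1 ((Expr.arc_iff hX).1 hab).2.2)
    exact (key 1 h).reject hd1
  · intro h
    -- sequences of digits as vertices
    have hex : ∀ f : Fin 8 → ℕ, ∃ v, (∀ i, f i < X) → v < X ^ 8 ∧ digit X v = f := by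
      intro f
      by_cases hf : ∀ i, f i < X
      · obtain ⟨v, hv⟩ := exists_digit_eq hf
        exact ⟨v, fun _ => hv⟩
      · exact ⟨0, fun h => absurd h hf⟩
    choose V hV using hex
    have harc : ∀ f g : Fin 8 → ℕ, (∀ i, f i < X) → (∀ i, g i < X) →
        ConfigArc c (inputMem z.encode) N f g →
        Relation.ReflTransGen ((configExpr c).Arc z.encode) (V f) (V g) := by
      intro f g hf hg hfg
      obtain ⟨h1, h2⟩ := hV f hf
      obtain ⟨h3, h4⟩ := hV g hg
      refine .single ((Expr.arc_iff hX).2 ⟨h1, h3, eval_configExpr.2 ?_⟩)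
      rw [← hN, h2, h4]
      exact hfg
    have hstart : ∀ g : Fin 8 → ℕ, (∀ i, g i < X) →
        ConfigArc c (inputMem z.encode) N (digit X 0) g →
        Relation.ReflTransGen ((configExpr c).Arc z.encode) 0 (V g) := by
      intro g hg hfg
      obtain ⟨h3, h4⟩ := hV g hg
      refine .single ((Expr.arc_iff hX).2 ⟨h0lt, h3, eval_configExpr.2 ?_⟩)
      rw [← hN, h4]
      exact hfg
    have hend : ∀ f : Fin 8 → ℕ, (∀ i, f i < X) →
        ConfigArc c (inputMem z.encode) N f (digit X 1) →
        Relation.ReflTransGen ((configExpr c).Arc z.encode) (V f) 1 := by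
      intro f hf hfg
      obtain ⟨h1, h2⟩ := hV f hf
      refine .single ((Expr.arc_iff hX).2 ⟨h1, h1lt, eval_configExpr.2 ?_⟩)
      rw [← hN, h2]
      exact hfg
    have hnX : z.n < X ∧ (0 < z.n → 4 < X) := by
      rw [hX, length_encode]
      refine ⟨by nlinarith [Nat.zero_le (z.n * z.n * z.n)], fun h => ?_⟩
      have h1 : 0 < z.n * z.n := Nat.mul_pos h h
      have h2 : 0 < z.n * z.n * z.n := Nat.mul_pos h1 h
      omega
    have hsize : IsSize N z.n := hN ▸ z.isSize_length_iff.2 rfl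
    have hlt : ∀ {σ : ℕ} (u w : Fin z.n) {h k g l : ℕ}, σ ≤ 4 → h ≤ z.n → k ≤ z.n → g ≤ z.n →
        l ≤ z.n → ∀ i, (![σ, z.n, u, w, h, k, g, l] : Fin 8 → ℕ) i < X := by
      intro σ u w h k g l hσ hh hk hg hl i
      have := hnX.2 u.pos
      have := hnX.1
      fin_cases i <;> simp <;> omega
    rcases h with ⟨a, ha⟩ | ⟨a, h, g, k, l, hkl, f1, f2, f3, f4⟩ |
      ⟨u, v, ⟨h, g, k, l, hkl, f1, f2, f3, f4⟩, hvu⟩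
    · have key : ∀ j ≤ z.n, Relation.ReflTransGen ((configExpr c).Arc z.encode) 0
          (V ![2, z.n, a, a, j, 0, 0, 0]) := by
        intro j hj
        induction j with
        | zero =>
          exact hstart _ (hlt _ _ (by omega) (by omega) (by omega) (by omega) (by omega))
            (.start_scan hd0 hsize a.2)
        | succ j ih =>
          refine (ih (by omega)).trans (harc _ _
            (hlt _ _ (by omega) (by omega) (by omega) (by omega) (by omega))
            (hlt _ _ (by omega) (by omega) (by omega) (by omega) (by omega))
            (.scan hj ?_))
          by_contra hne
          have := (z.inputMem_tableAddr le_rfl a ⟨j, hj⟩).1 hne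
          rw [show z.table 1 = z.matching from rfl, ha] at this
          cases this
      exact (key _ le_rfl).trans (hend _
        (hlt _ _ (by omega) le_rfl (by omega) (by omega) (by omega))
        (.scan_reject hd1))
    · refine (hstart ![3, z.n, a, a, h, k, g, l]
        (hlt _ _ (by omega) h.2.le k.2.le g.2.le l.2.le)
        (.start_walk hd0 hsize a.2)).trans (hend _
        (hlt _ _ (by omega) h.2.le k.2.le g.2.le l.2.le)
        (.first_reject ?_ hkl ?_ hd1))
      · exact isGuess_vec f1 f2 f3
      · exact (z.inputMem_tableAddr (by omega) a h).2 f4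
    · -- the rest of the closed walk
      have key : ∃ h' k' g' l' : ℕ, h' ≤ z.n ∧ k' ≤ z.n ∧ g' ≤ z.n ∧ l' ≤ z.n ∧
          Relation.ReflTransGen ((configExpr c).Arc z.encode)
            (V ![4, z.n, u, v, h', k', g', l']) 1 := by
        clear f4
        induction hvu using Relation.ReflTransGen.head_induction_on with
        | refl =>
          refine ⟨0, 0, 0, 0, by omega, by omega, by omega, by omega, hend _
            (hlt _ _ le_rfl (by omega) (by omega) (by omega) (by omega))
            (.walk_reject hd1)⟩
        | @head v w hvw _ ih =>
          obtain ⟨h', k', g', l', b1, b2, b3, b4, hreach⟩ := ih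
          obtain ⟨h'', g'', k'', l'', hkl', e1, e2, e3, e4⟩ := hvw
          refine ⟨h'', k'', g'', l'', h''.2.le, k''.2.le, g''.2.le, l''.2.le, (harc _ _
            (hlt _ _ le_rfl h''.2.le k''.2.le g''.2.le l''.2.le) (hlt _ _ le_rfl b1 b2 b3 b4)
            (.walk ?_ hkl' w.2 ?_)).trans
                hreach⟩
          · exact isGuess_vec e1 e2 e3
          · exact (z.inputMem_tableAddr hc w h'').2 e4
      obtain ⟨h', k', g', l', b1, b2, b3, b4, hreach⟩ := key
      refine (hstart ![3, z.n, u, u, h, k, g, l]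
        (hlt _ _ (by omega) h.2.le k.2.le g.2.le l.2.le)
        (.start_walk hd0 hsize u.2)).trans ((harc _ _
        (hlt _ _ (by omega) h.2.le k.2.le g.2.le l.2.le) (hlt _ _ le_rfl b1 b2 b3 b4)
        (.first ?_ hkl v.2 ?_)).trans hreach)
      · exact isGuess_vec f1 f2 f3
      · exact (z.inputMem_tableAddr hc v h).2 f4

end MarketWithMatching

/-! ### What the search decides -/

namespace MarketWithMatching

open HousingAllocation HousingMarket

variable {z : MarketWithMatching} {c : ℕ} {u v : Fin z.n}

theorem lt_of_getElem?_pref {i : ℕ} {h : Fin z.n} (hi : (z.market.pref u)[i]? = some h) :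
    i < z.n := by
  have h1 := (List.getElem?_eq_some_iff.1 hi).1
  have h2 := (z.market.pref_nodup u).length_le_card
  rw [Fintype.card_fin] at h2
  omega

theorem TradeArc.prefers (h : z.TradeArc c (· < ·) u v) :
    z.market.Prefers u ((z.table c).house v) (z.matching.house u) := by
  obtain ⟨h, g, k, l, hkl, f1, f2, f3, f4⟩ := h
  rw [f1, f4]
  exact ⟨k, l, hkl, f3, f2⟩

theorem TradeArc.eq_or_prefers (h : z.TradeArc c (· ≤ ·) u v) :
    z.matching.house u = (z.table c).house v ∨
      z.market.Prefers u ((z.table c).house v) (z.matching.house u) := by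
  obtain ⟨h, g, k, l, hkl, f1, f2, f3, f4⟩ := h
  rcases hkl.eq_or_lt with heq | hlt
  · rw [Fin.val_fin_le.1 hkl |>.eq_of_not_lt (by omega), f2] at f3
    exact Or.inl (by rw [f1, f4, f3])
  · exact Or.inr (TradeArc.prefers ⟨h, g, k, l, hlt, f1, f2, f3, f4⟩)

theorem TradeArc.of_prefers (hu : ∃ g, z.matching.house u = some g)
    (h : z.market.Prefers u ((z.table c).house v) (z.matching.house u)) :
    z.TradeArc c (· < ·) u v := by
  obtain ⟨g, hg⟩ := hu
  obtain ⟨h', hh', -⟩ := exists_eq_some_of_prefers h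
  rw [hg, hh'] at h
  obtain ⟨k, l, hkl, hk, hl⟩ := h
  exact ⟨h', g, ⟨k, lt_of_getElem?_pref hk⟩, ⟨l, lt_of_getElem?_pref hl⟩, hkl, hg, hl, hk, hh'⟩

theorem TradeArc.of_eq (hu : ∃ g, z.matching.house u = some g)
    (h : z.matching.house u = (z.table c).house v) : z.TradeArc c (· ≤ ·) u v := by
  obtain ⟨g, hg⟩ := hu
  obtain ⟨l, hl⟩ := List.getElem?_of_mem (z.matching.acceptable u g hg)
  exact ⟨g, g, ⟨l, lt_of_getElem?_pref hl⟩, ⟨l, lt_of_getElem?_pref hl⟩, le_rfl, hg, hl, hl,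
    h ▸ hg⟩

theorem TradeArc.le_of_lt (h : z.TradeArc c (· < ·) u v) : z.TradeArc c (· ≤ ·) u v := by
  obtain ⟨h, g, k, l, hkl, hr⟩ := h
  exact ⟨h, g, k, l, hkl.le, hr⟩

theorem core_eq_singleton_iff_not_rejected :
    z.market.core = {z.matching} ↔ ¬ z.Rejected 0 := by
  rw [core_eq_singleton_iff]
  refine not_congr ⟨fun ⟨u, v, huv, hvu⟩ => ?_, ?_⟩
  · by_cases hnone : ∃ a, z.matching.house a = none
    · exact Or.inl hnone
    have hsome : ∀ a, ∃ g, z.matching.house a = some g := fun a =>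
      Option.ne_none_iff_exists'.1 fun h => hnone ⟨a, h⟩
    refine Or.inr (Or.inr ⟨u, v, .of_prefers (hsome u) huv, ?_⟩)
    refine Relation.ReflTransGen.mono (fun a b hab => ?_) _ _ hvu
    rcases hab with h | h
    · exact .of_eq (hsome a) h
    · exact (TradeArc.of_prefers (c := 0) (hsome a) h).le_of_lt
  · rintro (⟨a, ha⟩ | ⟨a, ha⟩ | ⟨u, v, huv, hvu⟩)
    · exact ⟨a, a, dashedArc_self_of_eq_none ha, .refl⟩
    · exact ⟨a, a, ha.prefers, .refl⟩
    · exact ⟨u, v, huv.prefers, Relation.ReflTransGen.mono (fun a b h => h.eq_or_prefers) _ _ hvu⟩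

theorem individuallyRational_iff (hsome : ∀ a, ∃ g, z.matching.house a = some g) :
    z.market.IndividuallyRational z.matching ↔ ¬ ∃ a, z.TradeArc 0 (· < ·) a a := by
  rw [not_exists]
  refine forall_congr' fun a => ⟨fun h ha => ?_, fun h => ?_⟩
  · have hp := ha.prefers
    rcases h with h | h
    · rw [h] at hp
      exact prefers_irrefl hp
    · exact prefers_asymm h hp
  · rcases prefers_trichotomy (z.matching.acceptable a) (z.market.endowment.acceptable a) with
      h' | h' | h'
    · exact Or.inr h'
    · exact Or.inl h'
    · exact absurd (TradeArc.of_prefers (c := 0) (hsome a) h') h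

theorem individuallyRational_and_paretoOptimal_iff_not_rejected :
    z.market.IndividuallyRational z.matching ∧ z.matching.ParetoOptimal ↔ ¬ z.Rejected 1 := by
  by_cases hsome : ∀ a, ∃ g, z.matching.house a = some g
  swap
  · refine iff_of_false (fun h => hsome h.1.exists_eq_some) (not_not.2 (Or.inl ?_))
    by_contra hnone
    exact hsome fun a => Option.ne_none_iff_exists'.1 fun h => hnone ⟨a, h⟩
  have hnone : ¬ ∃ a, z.matching.house a = none := fun ⟨a, ha⟩ => by
    obtain ⟨g, hg⟩ := hsome a
    rw [ha] at hg
    cases hg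
  rw [Rejected, or_iff_right hnone, not_or, ← individuallyRational_iff hsome]
  refine and_congr_right fun hir => ?_
  rw [hir.paretoOptimal_iff]
  refine not_congr (exists_congr fun u => exists_congr fun v => and_congr
    ⟨fun h => .of_prefers (hsome u) h, fun h => h.prefers⟩ ⟨fun h => ?_, fun h => ?_⟩)
  · exact Relation.ReflTransGen.mono (fun a b hab =>
      (TradeArc.of_prefers (c := 1) (hsome a) hab).le_of_lt) _ _ h
  · induction h with
    | refl => exact .refl
    | @tail a b _ hab ih =>
      -- an arc that is not strict is a loop
      rcases hab.eq_or_prefers with h | h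
      · obtain ⟨g, hg⟩ := hsome a
        obtain rfl := z.matching.injective a b g hg (h ▸ hg)
        exact ih
      · exact ih.tail h

end MarketWithMatching

theorem mainTheorem4 :
    PRAM.InNC MarketWithMatching.encode
      (fun z => z.market.IndividuallyRational z.matching ∧ z.matching.ParetoOptimal) ∧
    PRAM.InNC MarketWithMatching.encode
      (fun z => z.market.core = {z.matching}) ∧
    (∀ (n : ℕ) (M : HousingMarket n) (μ : M.Matching), M.IndividuallyRational μ →
      (μ.ParetoOptimal ↔
        ¬ ∃ (k : ℕ) (c : Fin (k + 1) → Fin n), IsDirectedCycle (M.EnvyArc μ) c)) ∧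
    (∀ (n : ℕ) (M : HousingMarket n) (μ : M.Matching),
      M.core = {μ} ↔
        ¬ ∃ (k : ℕ) (c : Fin (k + 1) → Fin n),
          IsDirectedCycle (fun u v => M.SolidArc μ u v ∨ M.DashedArc μ u v) c ∧
            ∃ i, M.DashedArc μ (c i) (c (i + 1))) := by
  refine ⟨PRAM.inNC_of_reach (PRAM.configExpr 1) fun z => ?_,
    PRAM.inNC_of_reach (PRAM.configExpr 0) fun z => ?_,
    fun n M μ hμ => ?_, fun n M μ => ?_⟩
  · rw [MarketWithMatching.reflTransGen_arc_iff le_rfl,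
      MarketWithMatching.individuallyRational_and_paretoOptimal_iff_not_rejected]
  · rw [MarketWithMatching.reflTransGen_arc_iff zero_le_one,
      MarketWithMatching.core_eq_singleton_iff_not_rejected]
  · rw [hμ.paretoOptimal_iff, ← exists_isDirectedCycle_iff fun _ _ => id]
    exact not_congr (exists_congr fun k => exists_congr fun c =>
      ⟨fun h => h.1, fun h => ⟨h, 0, h.2 0⟩⟩)
  · rw [HousingMarket.core_eq_singleton_iff]
    exact not_congr (exists_isDirectedCycle_iff fun _ _ => Or.inr).symm
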